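/- Let $X$ be a connected simplicial set, $v_*\in X_0$ a vertex, and $T$ a maximal tree in the $1$-skeleton of $X$, i.e. a set of $1$-simplices containing no loops and no two edges with the same pair of end points, such that the graph with vertex set $X_0$ and edge set $T$ is a tree. Let $|X|$ be the geometric realization, and let the product in $\pi_1(|X|,v_*)$ be concatenation of loops (first factor first). For a $1$-simplex $e$ from $\partial_1 e$ to $\partial_0 e$ let $\tau'(e)\in\pi_1(|X|,v_*)$ be the class of the loop that runs inside $T$ from $v_*$ to $\partial_1 e$, then along $e$, then inside $T$ from $\partial_0 e$ back to $v_*$. Let $\chi:\pi_1(|X|,v_*)\to H$ be a surjective group homomorphism and define $\tau:X_n\to H$ for all $n \ge 0$ by: $\tau(v)=1$ for $v\in X_0$; $\tau(e)=1$ for $e\in T$ and for degenerate $e\in X_1$; $\tau(e)=\chi(\tau'(e))$ for all other $e\in X_1$; $\tau(\sigma)=\tau(\partial_0\sigma)$ for $\sigma\in X_n$, $n\ge 2$. Let $\tilde X$ be the simplicial set with $\tilde X_n=H\times X_n$, degeneracies $\tilde s_i(h,\sigma)=(h,s_i\sigma)$, and faces, for $\sigma\in X_n$ with $n\ge 1$,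 $\tilde\partial_i(h,\sigma)=(h,\partial_i\sigma)$ for $i<n$ and $\tilde\partial_n(h,\sigma)=(h\cdot\tau(\sigma)^{-1},\partial_n\sigma)$. Let $\pi:\tilde X\to X$ be the simplicial map $(h,\sigma)\mapsto\sigma$. Then the induced map $|\pi|:|\tilde X|\to|X|$ is a covering map between path-connected spaces: $|X|$ and $|\tilde X|$ are path-connected, and every point of $|X|$ has an open neighborhood $U$ such that $|\pi|^{-1}(U)$ is a disjoint union of open sets, each mapped homeomorphically onto $U$ by $|\pi|$. -/

import Mathlib

open CategoryTheory Opposite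

universe u

noncomputable section

namespace SimplicialCover

section

open Simplicial

/-! ### Simplices, vertices and edges inside the geometric realization -/

/-- The characteristic map `Δⁿ → |X|` of a simplex `σ` of `X`, from the standard topological
simplex to the geometric realization. -/
def charMap {X : SSet.{u}} {n : SimplexCategory} (σ : X.obj (op n)) :
    C(stdSimplex ℝ (Fin (n.len + 1)), SSet.toTop.obj X) :=
  TopCat.toSSetObjEquiv _ (op n) ((sSetTopAdj.unit.app X).app (op n) σ)

lemma charMap_map {X : SSet.{u}} {m n : SimplexCategory} (f : m ⟶ n) (σ : X.obj (op n))
    (z : stdSimplex ℝ (Fin (m.len + 1))) :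
    charMap (X.map f.op σ) z = charMap σ (stdSimplex.map f z) := by
  have h := NatTrans.naturality_apply (sSetTopAdj.unit.app X) f.op σ
  exact congrArg (fun s => TopCat.toSSetObjEquiv (SSet.toTop.obj X) (op m) s z) h

/-- The point of `|X|` given by a vertex of `X`. -/
def pt {X : SSet.{u}} (v : X _⦋0⦌) : SSet.toTop.obj X :=
  charMap v (stdSimplex.vertex (0 : Fin 1))

lemma charMap_vertex_zero {X : SSet.{u}} (e : X _⦋1⦌) :
    charMap e (stdSimplex.vertex (0 : Fin 2)) = pt (X.δ 1 e) := by
  refine Eq.trans ?_ (charMap_map (X := X) (SimplexCategory.δ 1) e _).symm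
  exact congrArg (charMap (n := ⦋1⦌) e)
    (stdSimplex.map_vertex (S := ℝ) (1 : Fin 2).succAbove (0 : Fin 1)).symm

lemma charMap_vertex_one {X : SSet.{u}} (e : X _⦋1⦌) :
    charMap e (stdSimplex.vertex (1 : Fin 2)) = pt (X.δ 0 e) := by
  refine Eq.trans ?_ (charMap_map (X := X) (SimplexCategory.δ 0) e _).symm
  exact congrArg (charMap (n := ⦋1⦌) e)
    (stdSimplex.map_vertex (S := ℝ) (0 : Fin 2).succAbove (0 : Fin 1)).symm

/-- The standard path in the topological `1`-simplex from vertex `0` to vertex `1`. -/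
def stdEdge : Path (stdSimplex.vertex (S := ℝ) (0 : Fin 2)) (stdSimplex.vertex (1 : Fin 2)) where
  toFun := stdSimplexHomeomorphUnitInterval.symm
  continuous_toFun := stdSimplexHomeomorphUnitInterval.symm.continuous
  source' := by
    rw [Homeomorph.symm_apply_eq]; exact stdSimplexHomeomorphUnitInterval_zero.symm
  target' := by
    rw [Homeomorph.symm_apply_eq]; exact stdSimplexHomeomorphUnitInterval_one.symm

/-- The path in `|X|` traced by an edge of `X` from the vertex `a` to the vertex `b`. -/
def edgePath {X : SSet.{u}} {a b : X _⦋0⦌} (e : SSet.Edge a b) : Path (pt a) (pt b) :=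
  (stdEdge.map (charMap (n := ⦋1⦌) e.edge).continuous).cast
    (by rw [charMap_vertex_zero, e.src_eq]) (by rw [charMap_vertex_one, e.tgt_eq])

/-- The homotopy class of an edge of `X`, an arrow of the fundamental groupoid of `|X|`. -/
def edgeArrow {X : SSet.{u}} {a b : X _⦋0⦌} (e : SSet.Edge a b) :
    FundamentalGroupoid.mk (pt a) ⟶ FundamentalGroupoid.mk (pt b) :=
  Path.Homotopic.Quotient.mk (edgePath e)

/-- The group `π₁(|X|, v)`. The product `p * q` is the class of the path that runs along `p` first
and then along `q`; Mathlib's `FundamentalGroup` has the opposite product. -/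
abbrev Pi1 (X : SSet.{u}) (v : X _⦋0⦌) : Type u :=
  (FundamentalGroup (SSet.toTop.obj X) (pt v))ᵐᵒᵖ

/-! ### Maximal trees -/

/-- The unordered pair of end points of an edge. -/
def ends {X : SSet.{u}} (e : X _⦋1⦌) : Sym2 (X _⦋0⦌) := s(X.δ 1 e, X.δ 0 e)

/-- A maximal tree in the `1`-skeleton of `X`: a set of `1`-simplices with no loops and no two
parallel or antiparallel edges which, as a graph on the set of all vertices of `X`, is a tree. -/
structure MaximalTree (X : SSet.{u}) where
  edges : Set (X _⦋1⦌)
  not_loop : ∀ e ∈ edges, X.δ 1 e ≠ X.δ 0 e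
  injOn_ends : Set.InjOn ends edges
  isTree : (SimpleGraph.fromEdgeSet (ends '' edges)).IsTree

namespace MaximalTree

variable {X : SSet.{u}} (T : MaximalTree X)

/-- The tree as a simple graph on the vertices of `X`. -/
def graph : SimpleGraph (X _⦋0⦌) := SimpleGraph.fromEdgeSet (ends '' T.edges)

lemma exists_edge {a b : X _⦋0⦌} (h : T.graph.Adj a b) :
    (∃ e : SSet.Edge a b, e.edge ∈ T.edges) ∨ (∃ e : SSet.Edge b a, e.edge ∈ T.edges) := by
  obtain ⟨⟨e, he, hab⟩, -⟩ := (SimpleGraph.fromEdgeSet_adj _).1 h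
  rcases Sym2.eq_iff.1 hab with ⟨rfl, rfl⟩ | ⟨rfl, rfl⟩
  · exact Or.inl ⟨SSet.Edge.mk' e, he⟩
  · exact Or.inr ⟨SSet.Edge.mk' e, he⟩

lemma adj {a b : X _⦋0⦌} (e : SSet.Edge a b) (he : e.edge ∈ T.edges) : T.graph.Adj a b := by
  refine (SimpleGraph.fromEdgeSet_adj _).2 ⟨⟨e.edge, he, ?_⟩, ?_⟩
  · rw [ends, e.src_eq, e.tgt_eq]
  · have h := T.not_loop _ he
    rwa [e.src_eq, e.tgt_eq] at h

open Classical in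
/-- The homotopy class in `|X|` of the tree edge joining two adjacent vertices, travelled along or
against its orientation. -/
def step {a b : X _⦋0⦌} (h : T.graph.Adj a b) :
    FundamentalGroupoid.mk (pt a) ⟶ FundamentalGroupoid.mk (pt b) :=
  if h' : ∃ e : SSet.Edge a b, e.edge ∈ T.edges then edgeArrow h'.choose
  else inv (edgeArrow ((T.exists_edge h).resolve_left h').choose)

lemma step_eq {a b : X _⦋0⦌} (e : SSet.Edge a b) (he : e.edge ∈ T.edges) :
    T.step (T.adj e he) = edgeArrow e := by
  have h' : ∃ e : SSet.Edge a b, e.edge ∈ T.edges := ⟨e, he⟩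
  rw [step, dif_pos h']
  congr 1
  apply SSet.Edge.ext
  refine T.injOn_ends h'.choose_spec he ?_
  simp only [ends, SSet.Edge.src_eq, SSet.Edge.tgt_eq]

lemma step_symm_eq {a b : X _⦋0⦌} (e : SSet.Edge a b) (he : e.edge ∈ T.edges) :
    T.step (T.adj e he).symm = inv (edgeArrow e) := by
  have h' : ¬ ∃ e : SSet.Edge b a, e.edge ∈ T.edges := by
    rintro ⟨e', he'⟩
    have h1 : e'.edge = e.edge := by
      refine T.injOn_ends he' he ?_
      simp only [ends, SSet.Edge.src_eq, SSet.Edge.tgt_eq]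
      exact Sym2.eq_swap
    have h2 := T.not_loop _ he
    apply h2
    rw [e.tgt_eq, ← h1, e'.src_eq]
  rw [step, dif_neg h']
  congr 2
  apply SSet.Edge.ext
  refine T.injOn_ends ((T.exists_edge (T.adj e he).symm).resolve_left h').choose_spec he ?_
  simp only [ends, SSet.Edge.src_eq, SSet.Edge.tgt_eq]

end MaximalTree

end

/-- The homotopy class in `|X|` of a walk in the tree. -/
def MaximalTree.walkArrow {X : SSet.{u}} (T : MaximalTree X) {a b : X.obj (op (.mk 0))} :
    T.graph.Walk a b → (FundamentalGroupoid.mk (pt a) ⟶ FundamentalGroupoid.mk (pt b))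
  | .nil => 𝟙 _
  | .cons h p => T.step h ≫ walkArrow T p

section

open Simplicial

namespace MaximalTree

variable {X : SSet.{u}} (T : MaximalTree X)

lemma walkArrow_concat {a b c : X _⦋0⦌} (p : T.graph.Walk a b) (h : T.graph.Adj b c) :
    T.walkArrow (p.concat h) = T.walkArrow p ≫ T.step h := by
  induction p with
  | nil => simp [walkArrow, SimpleGraph.Walk.concat]
  | cons h' p ih => rw [SimpleGraph.Walk.concat_cons, walkArrow, ih, walkArrow, Category.assoc]

/-- The unique path in the tree from `v` to `w`. -/
def treeWalk (v w : X _⦋0⦌) : T.graph.Walk v w :=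
  (T.isTree.existsUnique_path v w).choose

lemma treeWalk_isPath (v w : X _⦋0⦌) : (T.treeWalk v w).IsPath :=
  (T.isTree.existsUnique_path v w).choose_spec.1

/-- The homotopy class in `|X|` of the unique path in the tree from `v` to `w`. -/
def treeArrow (v w : X _⦋0⦌) : FundamentalGroupoid.mk (pt v) ⟶ FundamentalGroupoid.mk (pt w) :=
  T.walkArrow (T.treeWalk v w)

lemma treeArrow_comp (v : X _⦋0⦌) {a b : X _⦋0⦌} (e : SSet.Edge a b) (he : e.edge ∈ T.edges) :
    T.treeArrow v a ≫ edgeArrow e = T.treeArrow v b := by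
  have hadj := T.adj e he
  by_cases h : a ∈ (T.treeWalk v b).support
  · have := SimpleGraph.IsAcyclic.path_concat (G := T.graph) T.isTree.isAcyclic
      (T.treeWalk_isPath v a) (T.treeWalk_isPath v b) hadj h
    rw [treeArrow, treeArrow, this, walkArrow_concat, step_eq T e he]
  · have hb := SimpleGraph.IsAcyclic.mem_support_of_ne_mem_support_of_adj_of_isPath
      (G := T.graph) T.isTree.isAcyclic (T.treeWalk_isPath v a) (T.treeWalk_isPath v b) hadj h
    have := SimpleGraph.IsAcyclic.path_concat (G := T.graph) T.isTree.isAcyclic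
      (T.treeWalk_isPath v b) (T.treeWalk_isPath v a) hadj.symm hb
    rw [treeArrow, treeArrow, this, walkArrow_concat, step_symm_eq T e he]
    simp

/-- The element of `π₁(|X|, v)` given by an edge `e` from `a` to `b`: the class of the path in the
tree from `v` to `a`, followed by `e` and by the path in the tree from `b` back to `v`. -/
def loop (v : X _⦋0⦌) {a b : X _⦋0⦌} (e : SSet.Edge a b) : Pi1 X v :=
  MulOpposite.op (T.treeArrow v a ≫ edgeArrow e ≫ inv (T.treeArrow v b))

/-- The map from `1`-simplices of `X` to `π₁(|X|, v)` determined by the tree. -/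
def edgeClass (v : X _⦋0⦌) (e : X _⦋1⦌) : Pi1 X v := T.loop v (SSet.Edge.mk' e)

lemma loop_eq (v : X _⦋0⦌) {a b : X _⦋0⦌} (e : SSet.Edge a b) :
    T.loop v e = T.edgeClass v e.edge := by
  obtain ⟨e, rfl, rfl⟩ := e
  rfl

lemma edgeClass_of_mem (v : X _⦋0⦌) (e : X _⦋1⦌) (he : e ∈ T.edges) : T.edgeClass v e = 1 := by
  have := T.treeArrow_comp v (SSet.Edge.mk' e) he
  rw [edgeClass, loop, ← Category.assoc, this, IsIso.hom_inv_id]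
  rfl

end MaximalTree

/-! ### The relations given by degenerate edges and by triangles -/

lemma edgeArrow_degenerate {X : SSet.{u}} (v : X _⦋0⦌) :
    edgeArrow (SSet.Edge.id v) = 𝟙 (FundamentalGroupoid.mk (pt v)) := by
  have h : edgePath (SSet.Edge.id v) = Path.refl (pt v) := by
    ext t
    refine (charMap_map (X := X) (SimplexCategory.σ (0 : Fin 1)) v _).trans ?_
    exact congrArg _ (Subsingleton.elim (α := stdSimplex ℝ (Fin 1)) _ _)
  rw [edgeArrow, h]
  rfl

lemma trans_eq_of_simplyConnected {Y Z : Type*} [TopologicalSpace Y] [TopologicalSpace Z]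
    [SimplyConnectedSpace Y] (f : C(Y, Z)) {y₀ y₁ y₂ : Y} (p' : Path y₀ y₁) (q' : Path y₁ y₂)
    (r' : Path y₀ y₂) {a b c : Z} (p : Path a b) (q : Path b c) (r : Path a c)
    (hp : ∀ t, p t = f (p' t)) (hq : ∀ t, q t = f (q' t)) (hr : ∀ t, r t = f (r' t)) :
    (Path.Homotopic.Quotient.mk p).trans (Path.Homotopic.Quotient.mk q) =
      Path.Homotopic.Quotient.mk r := by
  obtain rfl : a = f y₀ := by simpa using hp 0
  obtain rfl : b = f y₁ := by simpa using hp 1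
  obtain rfl : c = f y₂ := by simpa using hq 1
  obtain rfl : p = p'.map f.continuous := by ext t; exact hp t
  obtain rfl : q = q'.map f.continuous := by ext t; exact hq t
  obtain rfl : r = r'.map f.continuous := by ext t; exact hr t
  rw [← Path.Homotopic.Quotient.mk_trans, ← Path.map_trans]
  exact Quotient.sound ((SimplyConnectedSpace.paths_homotopic (p'.trans q') r').map f)

lemma edgeArrow_triangle {X : SSet.{u}} (σ : X _⦋2⦌) {a b c : X _⦋0⦌} (p : SSet.Edge a b)
    (q : SSet.Edge b c) (r : SSet.Edge a c) (hp : p.edge = X.δ 2 σ) (hq : q.edge = X.δ 0 σ)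
    (hr : r.edge = X.δ 1 σ) : edgeArrow p ≫ edgeArrow q = edgeArrow r := by
  have : ContractibleSpace (stdSimplex ℝ (Fin 3)) :=
    (convex_stdSimplex ℝ (Fin 3)).contractibleSpace ⟨_, single_mem_stdSimplex ℝ 0⟩
  have key : ∀ (i : Fin 3) {x y : X _⦋0⦌} (e : SSet.Edge x y), e.edge = X.δ i σ → ∀ t,
      edgePath e t = charMap (n := ⦋2⦌) σ (stdSimplex.map i.succAbove (stdEdge t)) := by
    intro i x y e he t
    change charMap (n := ⦋1⦌) e.edge (stdEdge t) = _
    rw [he]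
    exact charMap_map (X := X) (SimplexCategory.δ i) σ (stdEdge t)
  refine trans_eq_of_simplyConnected (charMap (n := ⦋2⦌) σ)
    (y₀ := stdSimplex.vertex (0 : Fin 3)) (y₁ := stdSimplex.vertex (1 : Fin 3))
    (y₂ := stdSimplex.vertex (2 : Fin 3))
    ((stdEdge.map (stdSimplex.continuous_map (2 : Fin 3).succAbove)).cast ?_ ?_)
    ((stdEdge.map (stdSimplex.continuous_map (0 : Fin 3).succAbove)).cast ?_ ?_)
    ((stdEdge.map (stdSimplex.continuous_map (1 : Fin 3).succAbove)).cast ?_ ?_)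
    (edgePath p) (edgePath q) (edgePath r) (key 2 p hp) (key 0 q hq) (key 1 r hr) <;>
  · rw [stdSimplex.map_vertex]; rfl

lemma MaximalTree.edgeClass_degenerate {X : SSet.{u}} (T : MaximalTree X) (v w : X _⦋0⦌) :
    T.edgeClass v (X.σ 0 w) = 1 := by
  have := T.loop_eq v (SSet.Edge.id w)
  rw [SSet.Edge.id_edge] at this
  rw [← this, loop, edgeArrow_degenerate, Category.id_comp, IsIso.hom_inv_id]
  rfl

lemma MaximalTree.edgeClass_triangle {X : SSet.{u}} (T : MaximalTree X) (v : X _⦋0⦌)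
    (σ : X _⦋2⦌) :
    T.edgeClass v (X.δ 1 σ) = T.edgeClass v (X.δ 2 σ) * T.edgeClass v (X.δ 0 σ) := by
  let p : SSet.Edge (X.δ 1 (X.δ 2 σ)) (X.δ 0 (X.δ 2 σ)) := SSet.Edge.mk' (X.δ 2 σ)
  let q : SSet.Edge (X.δ 0 (X.δ 2 σ)) (X.δ 0 (X.δ 0 σ)) :=
    SSet.Edge.mk (X.δ 0 σ) (SSet.δ_comp_δ_apply (S := X) (i := 0) (j := 1) (by decide) σ).symm rfl
  let r : SSet.Edge (X.δ 1 (X.δ 2 σ)) (X.δ 0 (X.δ 0 σ)) :=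
    SSet.Edge.mk (X.δ 1 σ) (SSet.δ_comp_δ_apply (S := X) (i := 1) (j := 1) (by decide) σ).symm
      (SSet.δ_comp_δ_apply (S := X) (i := 0) (j := 0) (by decide) σ)
  have h := edgeArrow_triangle σ p q r rfl rfl rfl
  have hp : T.loop v p = T.edgeClass v (X.δ 2 σ) := T.loop_eq v p
  have hq : T.loop v q = T.edgeClass v (X.δ 0 σ) := T.loop_eq v q
  have hr : T.loop v r = T.edgeClass v (X.δ 1 σ) := T.loop_eq v r
  rw [← hp, ← hq, ← hr, loop, loop, loop, ← h, ← MulOpposite.op_mul]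
  congr 1
  rw [End.mul_def]
  simp

end

/-! ### The twisting map and the twisted simplicial set -/

open Classical in
/-- The twisting map `τ`: trivial on vertices, on edges of the tree and on degenerate edges, equal
to the image under `χ` of the class of the edge on all other edges, and extended to simplices of
higher dimension by `τ(σ) = τ(∂₀ σ)`. -/
def tau {X : SSet.{u}} (T : MaximalTree X) (v : X.obj (op (.mk 0))) {H : Type u} [Group H]
    (χ : Pi1 X v →* H) : (n : ℕ) → X.obj (op (.mk n)) → H
  | 0, _ => 1
  | 1, e => if e ∈ T.edges ∨ e ∈ X.degenerate 1 then 1 else χ (T.edgeClass v e)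
  | n + 2, σ => tau T v χ (n + 1) (X.δ 0 σ)

section Cover

open Simplicial

variable {X : SSet.{u}} (T : MaximalTree X) (v : X _⦋0⦌) {H : Type u} [Group H]
  (χ : Pi1 X v →* H)

lemma tau_one (e : X _⦋1⦌) : tau T v χ 1 e = χ (T.edgeClass v e) := by
  rw [tau]
  split_ifs with h
  · rcases h with h | h
    · rw [T.edgeClass_of_mem v e h, map_one]
    · rw [SSet.degenerate_eq_iUnion_range_σ] at h
      obtain ⟨i, w, rfl⟩ := Set.mem_iUnion.1 h
      obtain rfl : i = 0 := Subsingleton.elim (α := Fin 1) _ _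
      rw [T.edgeClass_degenerate v w, map_one]
  · rfl

/-- The value of `τ` on the edge of `σ` from its `i`-th to its `j`-th vertex. -/
def tauEdge {n : SimplexCategory} (σ : X.obj (op n)) (i j : Fin (n.len + 1)) (h : i ≤ j) : H :=
  tau T v χ 1 (X.map (SimplexCategory.mkOfLe (n := n.len) i j h).op σ)

lemma tauEdge_self {n : SimplexCategory} (σ : X.obj (op n)) (i : Fin (n.len + 1)) :
    tauEdge T v χ σ i i le_rfl = 1 := by
  have h : SimplexCategory.mkOfLe (n := n.len) i i le_rfl =
      SimplexCategory.σ 0 ≫ SimplexCategory.const ⦋0⦌ ⦋n.len⦌ i :=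
    SimplexCategory.Hom.ext_one_left _ _
  rw [tauEdge, tau_one, h, op_comp, Functor.map_comp_apply]
  exact (congrArg χ (T.edgeClass_degenerate v _)).trans (map_one χ)

lemma tauEdge_trans {n : SimplexCategory} (σ : X.obj (op n)) (i j k : Fin (n.len + 1))
    (h : i ≤ j) (h' : j ≤ k) :
    tauEdge T v χ σ i k (h.trans h') = tauEdge T v χ σ i j h * tauEdge T v χ σ j k h' := by
  let f := SimplexCategory.mkOfLeComp (n := n.len) i j k h h'
  have h0 : SimplexCategory.mkOfLe (n := n.len) j k h' = SimplexCategory.δ 0 ≫ f :=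
    SimplexCategory.Hom.ext_one_left _ _
  have h1 : SimplexCategory.mkOfLe (n := n.len) i k (h.trans h') = SimplexCategory.δ 1 ≫ f :=
    SimplexCategory.Hom.ext_one_left _ _
  have h2 : SimplexCategory.mkOfLe (n := n.len) i j h = SimplexCategory.δ 2 ≫ f :=
    SimplexCategory.Hom.ext_one_left _ _
  simp only [tauEdge, tau_one, h0, h1, h2, op_comp, Functor.map_comp_apply]
  rw [← map_mul]
  exact congrArg χ (T.edgeClass_triangle v (X.map f.op σ))

lemma tauEdge_map {m n : SimplexCategory} (f : m ⟶ n) (σ : X.obj (op n))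
    (i j : Fin (m.len + 1)) (h : i ≤ j) :
    tauEdge T v χ (X.map f.op σ) i j h =
      tauEdge T v χ σ (f.toOrderHom i) (f.toOrderHom j) (f.toOrderHom.monotone h) := by
  have h0 : SimplexCategory.mkOfLe (n := n.len) (f.toOrderHom i) (f.toOrderHom j)
      (f.toOrderHom.monotone h) = SimplexCategory.mkOfLe (n := m.len) i j h ≫ f :=
    SimplexCategory.Hom.ext_one_left _ _
  rw [tauEdge, tauEdge, h0, op_comp, Functor.map_comp_apply]

lemma tau_eq_tauEdge (n : ℕ) (σ : X _⦋n + 1⦌) :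
    tau T v χ (n + 1) σ =
      tauEdge T v χ σ (Fin.last n).castSucc (Fin.last (n + 1)) (Fin.le_last _) := by
  induction n with
  | zero =>
    have h : SimplexCategory.mkOfLe (n := 1) (Fin.last 0).castSucc (Fin.last 1) (Fin.le_last _) =
        𝟙 _ := SimplexCategory.Hom.ext_one_left _ _
    refine congrArg (tau T v χ 1) (Eq.symm ?_)
    refine (congrArg (fun f : (⦋1⦌ : SimplexCategory) ⟶ ⦋1⦌ => X.map f.op σ) h).trans ?_
    simp
  | succ n ih =>
    rw [tau, ih]
    exact tauEdge_map T v χ (SimplexCategory.δ 0) σ _ _ _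

/-- The simplicial set `X̃` with `n`-simplices `H × Xₙ`. A monotone map `θ : [m] → [n]` sends
`(h, σ)` to `(h · τ(e)⁻¹, θ^* σ)`, where `e` is the edge of `σ` from the vertex `θ(m)` to the last
vertex `n`. The three lemmas below give its faces and degeneracies. -/
def cover : SSet.{u} where
  obj n := H × X.obj n
  map {n m} θ := TypeCat.ofHom fun x =>
    (x.1 * (tauEdge T v χ (n := n.unop) x.2 (θ.unop.toOrderHom (Fin.last _)) (Fin.last _)
      (Fin.le_last _))⁻¹, X.map θ x.2)
  map_id n := by
    ext x
    · change x.1 * (tauEdge T v χ (n := n.unop) x.2 (Fin.last _) (Fin.last _) _)⁻¹ = x.1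
      rw [tauEdge_self, inv_one, mul_one]
    · change X.map (𝟙 n) x.2 = x.2
      simp
  map_comp {n m l} θ φ := by
    ext x
    · change x.1 * _ = (x.1 * _) * _
      have h := tauEdge_map T v χ θ.unop x.2 (φ.unop.toOrderHom (Fin.last _)) (Fin.last _)
        (Fin.le_last _)
      rw [mul_assoc, ← mul_inv_rev]
      congr 2
      exact (tauEdge_trans T v χ (n := n.unop) x.2 _ _ _
        (θ.unop.toOrderHom.monotone (Fin.le_last _)) (Fin.le_last _)).trans
        (congrArg (· * _) h.symm)
    · change X.map (θ ≫ φ) x.2 = X.map φ (X.map θ x.2)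
      simp

/-- `∂̃ᵢ(h, σ) = (h, ∂ᵢ σ)` for `i < n`, where `σ` has dimension `n`. -/
lemma cover_δ {n : ℕ} (i : Fin (n + 2)) (hi : i ≠ Fin.last (n + 1)) (h : H) (σ : X _⦋n + 1⦌) :
    (cover T v χ).δ i ((h, σ) : H × X _⦋n + 1⦌) = ((h, X.δ i σ) : H × X _⦋n⦌) := by
  refine Prod.ext ?_ rfl
  change h * (tauEdge T v χ σ (i.succAbove (Fin.last n)) (Fin.last (n + 1)) _)⁻¹ = h
  have : i.succAbove (Fin.last n) = Fin.last (n + 1) := Fin.succAbove_ne_last_last hi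
  have key : ∀ (j : Fin (n + 2)) (hj : j ≤ Fin.last (n + 1)), j = Fin.last (n + 1) →
      tauEdge T v χ (n := ⦋n + 1⦌) σ j (Fin.last (n + 1)) hj = 1 := by
    rintro j hj rfl
    exact tauEdge_self T v χ (n := ⦋n + 1⦌) σ _
  exact (congrArg (fun x => h * x⁻¹) (key _ _ this)).trans (by rw [inv_one, mul_one])

/-- `∂̃ₙ(h, σ) = (h · τ(σ)⁻¹, ∂ₙ σ)`, where `σ` has dimension `n`. -/
lemma cover_δ_last {n : ℕ} (h : H) (σ : X _⦋n + 1⦌) :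
    (cover T v χ).δ (Fin.last (n + 1)) ((h, σ) : H × X _⦋n + 1⦌) =
      ((h * (tau T v χ (n + 1) σ)⁻¹, X.δ (Fin.last (n + 1)) σ) : H × X _⦋n⦌) := by
  refine Prod.ext ?_ rfl
  rw [tau_eq_tauEdge]
  change h * (tauEdge T v χ σ ((Fin.last (n + 1)).succAbove (Fin.last n)) (Fin.last (n + 1)) _)⁻¹ =
    h * _
  have : (Fin.last (n + 1)).succAbove (Fin.last n) = (Fin.last n).castSucc :=
    Fin.succAbove_last_apply _
  congr 2
  congr 1

/-- `s̃ᵢ(h, σ) = (h, sᵢ σ)`. -/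
lemma cover_σ {n : ℕ} (i : Fin (n + 1)) (h : H) (σ : X _⦋n⦌) :
    (cover T v χ).σ i ((h, σ) : H × X _⦋n⦌) = ((h, X.σ i σ) : H × X _⦋n + 1⦌) := by
  refine Prod.ext ?_ rfl
  change h * (tauEdge T v χ σ (i.predAbove (Fin.last (n + 1))) (Fin.last n) _)⁻¹ = h
  have : i.predAbove (Fin.last (n + 1)) = Fin.last n := Fin.predAbove_right_last
  have key : ∀ (j : Fin (n + 1)) (hj : j ≤ Fin.last n), j = Fin.last n →
      tauEdge T v χ (n := ⦋n⦌) σ j (Fin.last n) hj = 1 := by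
    rintro j hj rfl
    exact tauEdge_self T v χ (n := ⦋n⦌) σ _
  exact (congrArg (fun x => h * x⁻¹) (key _ _ this)).trans (by rw [inv_one, mul_one])

/-- The simplicial map `π : X̃ → X`, `(h, σ) ↦ σ`. -/
def proj : cover T v χ ⟶ X where
  app _ := TypeCat.ofHom fun x => x.2
  naturality _ _ _ := rfl

end Cover

end SimplicialCover

end

noncomputable section

namespace SimplicialCover

open Simplicial Topology

/-! ### Maps out of the geometric realization -/

/-! The group `H` acts on `X̃` by left translation. This commutes with the faces because the twist
multiplies on the right. The operators change the `H`-component of a simplex, so `σ ↦ (1, σ)` is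
simplicial only modulo `H`; this is enough to identify `|X|` with the orbit space of `|X̃|`
(`orbitHomeo`). The covering property thus reduces to finding, around each point of `|X̃|`, a
neighbourhood disjoint from its nontrivial translates (`exists_nhds_disjoint`).

By the cocycle property of `τ`, every vertex of `(h, σ)` has a label in `H` that is compatible with
the operators, and translation by `g` multiplies all labels by `g`. A point of a simplex cuts `[0,
1]` into consecutive intervals, one for each vertex. For a monotone function `φ` on the line and a
label `k`, the total increment of `φ` over the intervals with label `k` is a continuous function on
`|X̃|`. If all the increase of `φ` takes place in one interval of the given point, then the set
where label `k` carries more than half of that increase is the required neighbourhood.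

The tree makes `|X|` path-connected. It also lifts to `X̃` with constant label, and an edge `e`
lifts to an edge that multiplies the label by `χ(τ'(e))`. As `χ` is surjective, path-connectedness
of `|X̃|` follows once the classes `τ'(e)` generate `π₁(|X|, v)` (`closure_range_edgeClass`). For
this, every path is shown to be generated, up to homotopy, by paths inside simplices
(`simplexGenerated`): a path lies in a skeleton by compactness, and induction on dimension splits it
into pieces that either stay in an open top cell or can be pushed radially into a lower skeleton.
Inside a simplex, which is contractible, moving from one vertex to another costs just an edge class.
-/

lemma charMap_apply_eq {X : SSet.{u}} {n : SimplexCategory} (σ : X.obj (op n)) {Z : TopCat.{u}}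
    (f : SSet.toTop.obj X ⟶ Z) (z : stdSimplex ℝ (Fin (n.len + 1))) :
    f (charMap σ z) =
      TopCat.toSSetObjEquiv Z (op n) ((sSetTopAdj.homEquiv X Z f).app (op n) σ) z := by
  rw [Adjunction.homEquiv_unit]
  rfl

lemma toTop_map_charMap {X Y : SSet.{u}} (f : X ⟶ Y) {n : SimplexCategory} (σ : X.obj (op n))
    (z : stdSimplex ℝ (Fin (n.len + 1))) :
    SSet.toTop.map f (charMap σ z) = charMap (f.app (op n) σ) z := by
  rw [charMap_apply_eq]
  rw [Adjunction.homEquiv_unit, Adjunction.unit_naturality]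
  rfl

lemma ext_of_charMap {X : SSet.{u}} {Z : Type u} [TopologicalSpace Z]
    {f g : C(SSet.toTop.obj X, Z)}
    (h : ∀ (n : SimplexCategory) (σ : X.obj (op n)) (z), f (charMap σ z) = g (charMap σ z)) :
    f = g := by
  suffices h' : TopCat.ofHom f = TopCat.ofHom g from congrArg TopCat.Hom.hom h'
  apply (sSetTopAdj.homEquiv X (TopCat.of Z)).injective
  ext ⟨n⟩ σ
  apply (TopCat.toSSetObjEquiv (TopCat.of Z) (op n)).injective
  ext z
  exact (charMap_apply_eq σ (TopCat.ofHom f) z).symm.trans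
    ((h n σ z).trans (charMap_apply_eq σ (TopCat.ofHom g) z))

/-- A family of continuous maps on the standard simplices which is compatible with the simplicial
operators, as a simplicial map to the singular simplicial set. -/
def toSingular {X : SSet.{u}} {Z : Type u} [TopologicalSpace Z]
    (g : ∀ (n : SimplexCategory) (_ : X.obj (op n)), C(stdSimplex ℝ (Fin (n.len + 1)), Z))
    (hg : ∀ ⦃m n : SimplexCategory⦄ (f : m ⟶ n) (σ : X.obj (op n)) (z),
      g m (X.map f.op σ) z = g n σ (stdSimplex.map f z)) :
    X ⟶ TopCat.toSSet.obj (TopCat.of Z) where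
  app n := TypeCat.ofHom fun σ => (TopCat.toSSetObjEquiv (TopCat.of Z) n).symm (g n.unop σ)
  naturality n m f := by
    ext σ
    apply (TopCat.toSSetObjEquiv (TopCat.of Z) m).injective
    ext z
    have := hg f.unop σ z
    change TopCat.toSSetObjEquiv (TopCat.of Z) m ((TopCat.toSSetObjEquiv (TopCat.of Z) m).symm
      (g m.unop (X.map f σ))) z = g n.unop σ (stdSimplex.map f.unop z)
    rw [Equiv.apply_symm_apply]
    exact this

/-- The continuous map on the geometric realization glued from a compatible family of continuous
maps on the standard simplices. -/
def descend {X : SSet.{u}} {Z : Type u} [TopologicalSpace Z]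
    (g : ∀ (n : SimplexCategory) (_ : X.obj (op n)), C(stdSimplex ℝ (Fin (n.len + 1)), Z))
    (hg : ∀ ⦃m n : SimplexCategory⦄ (f : m ⟶ n) (σ : X.obj (op n)) (z),
      g m (X.map f.op σ) z = g n σ (stdSimplex.map f z)) : C(SSet.toTop.obj X, Z) :=
  ((sSetTopAdj.homEquiv X (TopCat.of Z)).symm (toSingular g hg)).hom

@[simp]
lemma descend_charMap {X : SSet.{u}} {Z : Type u} [TopologicalSpace Z]
    (g : ∀ (n : SimplexCategory) (_ : X.obj (op n)), C(stdSimplex ℝ (Fin (n.len + 1)), Z))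
    (hg : ∀ ⦃m n : SimplexCategory⦄ (f : m ⟶ n) (σ : X.obj (op n)) (z),
      g m (X.map f.op σ) z = g n σ (stdSimplex.map f z)) {n : SimplexCategory}
    (σ : X.obj (op n)) (z : stdSimplex ℝ (Fin (n.len + 1))) :
    descend g hg (charMap σ z) = g n σ z := by
  refine (charMap_apply_eq (Z := TopCat.of Z) σ _ z).trans ?_
  rw [Equiv.apply_symm_apply]
  change TopCat.toSSetObjEquiv (TopCat.of Z) (op n) ((TopCat.toSSetObjEquiv (TopCat.of Z)
    (op n)).symm (g n σ)) z = _
  rw [Equiv.apply_symm_apply]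

/-- A real-valued version of `descend`. -/
lemma exists_real_map {X : SSet.{u}}
    (g : ∀ (n : SimplexCategory) (_ : X.obj (op n)), C(stdSimplex ℝ (Fin (n.len + 1)), ℝ))
    (hg : ∀ ⦃m n : SimplexCategory⦄ (f : m ⟶ n) (σ : X.obj (op n)) (z),
      g m (X.map f.op σ) z = g n σ (stdSimplex.map f z)) :
    ∃ G : C(SSet.toTop.obj X, ℝ), ∀ (n : SimplexCategory) (σ : X.obj (op n)) (z),
      G (charMap σ z) = g n σ z := by
  refine ⟨.comp ⟨ULift.down, continuous_uliftDown⟩ (descend (Z := ULift.{u} ℝ)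
    (fun n σ => .comp ⟨ULift.up, continuous_uliftUp⟩ (g n σ))
    fun _ _ f σ z => congrArg ULift.up (hg f σ z)), fun n σ z => ?_⟩
  exact congrArg ULift.down (descend_charMap _ _ σ z)

/-- Into an indiscrete space every map is continuous, so the universal property of `|X|` also
decides set-level questions: membership in the union of the simplices agrees with the constant
`True` on every simplex, hence everywhere. -/
lemma exists_charMap_eq {X : SSet.{u}} (x : SSet.toTop.obj X) :
    ∃ (n : SimplexCategory) (σ : X.obj (op n)) (z : _), charMap σ z = x := by
  let : TopologicalSpace (ULift.{u} Prop) := ⊤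
  let f : C(SSet.toTop.obj X, ULift.{u} Prop) := ⟨fun x => ⟨∃ (n : SimplexCategory)
    (σ : X.obj (op n)) (z : _), charMap σ z = x⟩, continuous_top⟩
  let g : C(SSet.toTop.obj X, ULift.{u} Prop) := ⟨fun _ => ⟨True⟩, continuous_top⟩
  have h : f = g := ext_of_charMap fun n σ z =>
    congrArg ULift.up (eq_true ⟨n, σ, z, rfl⟩)
  exact of_eq_true (congrArg ULift.down (congrArg (fun k : C(_, _) => k x) h))

/-- A predicate on pairs of a simplex and a point of the standard simplex that is compatible with
the simplicial operators only depends on the point of the geometric realization. -/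
lemma iff_of_charMap_eq {X : SSet.{u}}
    (P : ∀ (n : SimplexCategory) (_ : X.obj (op n)) (_ : stdSimplex ℝ (Fin (n.len + 1))), Prop)
    (hP : ∀ ⦃m n : SimplexCategory⦄ (f : m ⟶ n) (σ : X.obj (op n)) (z),
      P m (X.map f.op σ) z ↔ P n σ (stdSimplex.map f z))
    {m n : SimplexCategory} {σ : X.obj (op m)} {τ : X.obj (op n)}
    {z : stdSimplex ℝ (Fin (m.len + 1))} {w : stdSimplex ℝ (Fin (n.len + 1))}
    (h : charMap σ z = charMap τ w) : P m σ z ↔ P n τ w := by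
  let : TopologicalSpace (ULift.{u} Prop) := ⊤
  let f : C(SSet.toTop.obj X, ULift.{u} Prop) := descend
    (fun n σ => ⟨fun z => ⟨P n σ z⟩, continuous_top⟩)
    fun _ _ f σ z => congrArg ULift.up (propext (hP f σ z))
  have h1 : f (charMap σ z) = ⟨P m σ z⟩ := descend_charMap _ _ σ z
  have h2 : f (charMap τ w) = ⟨P n τ w⟩ := descend_charMap _ _ τ w
  rw [h, h2] at h1
  exact iff_of_eq (congrArg ULift.down h1).symm

/-- Open sets are continuous maps to the Sierpiński space, and such maps glue by the universal
property. -/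
lemma isClosed_iff_charMap {X : SSet.{u}} {C : Set (SSet.toTop.obj X)} :
    IsClosed C ↔ ∀ (n : SimplexCategory) (σ : X.obj (op n)), IsClosed (charMap σ ⁻¹' C) := by
  refine ⟨fun h n σ => h.preimage (charMap σ).continuous, fun h => ?_⟩
  let f : C(SSet.toTop.obj X, ULift.{u} Prop) := descend
    (fun n σ => ⟨fun z => ⟨charMap σ z ∈ Cᶜ⟩,
      continuous_uliftUp.comp (continuous_Prop.2 (h n σ).isOpen_compl)⟩)
    fun _ _ f σ z => by simp [charMap_map]
  have hf : Cᶜ = {x | (f x).down} := by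
    ext x
    obtain ⟨n, σ, z, rfl⟩ := exists_charMap_eq x
    have h' : f (charMap σ z) = ⟨charMap σ z ∈ Cᶜ⟩ := descend_charMap _ _ σ z
    exact iff_of_eq (congrArg ULift.down h').symm
  rw [← isOpen_compl_iff, hf]
  exact continuous_Prop.1 (continuous_uliftDown.comp f.continuous)

lemma continuous_toTop_map {X Y : SSet.{u}} (f : X ⟶ Y) : Continuous (SSet.toTop.map f) :=
  (SSet.toTop.map f).hom.continuous

/-! ### Masses of subintervals -/

/-- The increment of `φ` along the `i`-th of the consecutive intervals with lengths `z 0, z 1, …`. -/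
def mass (φ : C(ℝ, ℝ)) {n : ℕ} (z : stdSimplex ℝ (Fin n)) (i : Fin n) : ℝ :=
  φ (∑ j ∈ Finset.Iic i, z j) - φ (∑ j ∈ Finset.Iio i, z j)

lemma continuous_coord {ι : Type*} [Fintype ι] (i : ι) :
    Continuous fun z : stdSimplex ℝ ι => z i :=
  (continuous_apply i).comp continuous_subtype_val

lemma continuous_mass (φ : C(ℝ, ℝ)) {n : ℕ} (i : Fin n) : Continuous fun z => mass φ z i := by
  unfold mass
  have := fun j : Fin n => continuous_coord j
  fun_prop

/-- The intervals of a lower set fill an interval that starts at `0`, so the increments telescope.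
-/
lemma sum_mass_of_isLowerSet (φ : C(ℝ, ℝ)) {n : ℕ} (z : stdSimplex ℝ (Fin n))
    (S : Finset (Fin n)) (hS : ∀ i ∈ S, ∀ j ≤ i, j ∈ S) :
    ∑ i ∈ S, mass φ z i = φ (∑ i ∈ S, z i) - φ 0 := by
  induction S using Finset.strongInduction with
  | H S ih =>
    rcases S.eq_empty_or_nonempty with rfl | hne
    · simp
    · obtain ⟨m, hm⟩ : ∃ m, S = Finset.Iic m := by
        refine ⟨S.max' hne, ?_⟩
        ext i
        exact ⟨fun hi => Finset.mem_Iic.2 (S.le_max' i hi),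
          fun hi => hS _ (S.max'_mem hne) _ (Finset.mem_Iic.1 hi)⟩
      subst hm
      have h := ih (Finset.Iio m) (by
        rw [← Finset.Iic_erase]
        exact Finset.erase_ssubset (by simp)) fun i hi j hj => by
          simp only [Finset.mem_Iio] at hi ⊢
          exact lt_of_le_of_lt hj hi
      rw [← Finset.Iio_insert m, Finset.sum_insert (by simp), h, Finset.Iio_insert, mass]
      ring

lemma sum_map {ι κ : Type*} [Fintype ι] [Fintype κ] [DecidableEq κ] (f : ι → κ)
    (z : stdSimplex ℝ ι) (S : Finset κ) :
    ∑ j ∈ S, stdSimplex.map f z j = ∑ i with f i ∈ S, z i := by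
  simp only [stdSimplex.map_coe, FunOnFinite.linearMap_apply_apply]
  rw [Finset.sum_fiberwise_eq_sum_filter]

/-- A monotone map merges consecutive intervals: those in the fibre over `j` fill the `j`-th
interval of the image point. For `φ = id` these are the barycentric coordinates; a general `φ`
allows the mass to be concentrated on a single vertex. -/
lemma mass_map (φ : C(ℝ, ℝ)) {m n : ℕ} (f : Fin m → Fin n) (hf : Monotone f)
    (z : stdSimplex ℝ (Fin m)) (j : Fin n) :
    mass φ (stdSimplex.map f z) j = ∑ i with f i = j, mass φ z i := by
  have h1 := sum_mass_of_isLowerSet φ z {i | f i ∈ Finset.Iic j} fun i hi k hk => by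
    simp only [Finset.mem_Iic, Finset.mem_filter, Finset.mem_univ, true_and] at hi ⊢
    exact (hf hk).trans hi
  have h2 := sum_mass_of_isLowerSet φ z {i | f i ∈ Finset.Iio j} fun i hi k hk => by
    simp only [Finset.mem_Iio, Finset.mem_filter, Finset.mem_univ, true_and] at hi ⊢
    exact (hf hk).trans_lt hi
  have h3 : ∑ i with f i ∈ Finset.Iic j, mass φ z i =
      ∑ i with f i ∈ Finset.Iio j, mass φ z i + ∑ i with f i = j, mass φ z i := by
    rw [← Finset.sum_union]
    · congr 1
      ext i
      simp [le_iff_lt_or_eq]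
    · rw [Finset.disjoint_filter]
      intro i _ h h'
      simp [h'] at h
  rw [mass, sum_map, sum_map]
  linarith

lemma mass_nonneg {φ : C(ℝ, ℝ)} (hφ : Monotone φ) {n : ℕ} (z : stdSimplex ℝ (Fin n))
    (i : Fin n) : 0 ≤ mass φ z i :=
  sub_nonneg.2 (hφ (Finset.sum_le_sum_of_subset_of_nonneg (Finset.Iio_subset_Iic_self)
    fun _ _ _ => stdSimplex.zero_le z _))

lemma sum_mass (φ : C(ℝ, ℝ)) {n : ℕ} (z : stdSimplex ℝ (Fin n)) :
    ∑ i, mass φ z i = φ 1 - φ 0 := by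
  rw [sum_mass_of_isLowerSet φ z Finset.univ (by simp), stdSimplex.sum_eq_one]

section Covering

variable {X : SSet.{u}} (T : MaximalTree X) (v : X _⦋0⦌) {H : Type u} [Group H]
  (χ : Pi1 X v →* H)

/-! ### The action on the twisted simplicial set -/

/-- The simplex `(h, σ)` of the twisted simplicial set. -/
def lift (h : H) {n : SimplexCategory} (σ : X.obj (op n)) : (cover T v χ).obj (op n) := (h, σ)

lemma exists_lift {n : SimplexCategory} (x : (cover T v χ).obj (op n)) :
    ∃ (h : H) (σ : X.obj (op n)), x = lift T v χ h σ := ⟨x.1, x.2, rfl⟩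

lemma map_lift {m n : SimplexCategory} (f : m ⟶ n) (h : H) (σ : X.obj (op n)) :
    (cover T v χ).map f.op (lift T v χ h σ) =
      lift T v χ (h * (tauEdge T v χ σ (f.toOrderHom (Fin.last _)) (Fin.last _)
        (Fin.le_last _))⁻¹) (X.map f.op σ) := rfl

/-- Left translation on the twisted simplicial set. -/
def translate (g : H) : cover T v χ ⟶ cover T v χ where
  app _ := TypeCat.ofHom fun x => (g * x.1, x.2)
  naturality n m f := by
    ext x
    exact Prod.ext (mul_assoc (G := H) _ _ _).symm rfl

instance : MulAction H (SSet.toTop.obj (cover T v χ)) where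
  smul g := SSet.toTop.map (translate T v χ g)
  one_smul x := by
    have : translate T v χ 1 = 𝟙 _ := by
      ext n x
      exact Prod.ext (one_mul (M := H) _) rfl
    change SSet.toTop.map (translate T v χ 1) x = x
    rw [this]
    simp
  mul_smul g g' x := by
    have : translate T v χ (g * g') = translate T v χ g' ≫ translate T v χ g := by
      ext n x
      exact Prod.ext (mul_assoc (G := H) _ _ _) rfl
    change SSet.toTop.map (translate T v χ (g * g')) x =
      SSet.toTop.map (translate T v χ g) (SSet.toTop.map (translate T v χ g') x)
    rw [this]
    simp

instance : ContinuousConstSMul H (SSet.toTop.obj (cover T v χ)) where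
  continuous_const_smul g := continuous_toTop_map (translate T v χ g)

lemma smul_charMap (g h : H) {n : SimplexCategory} (σ : X.obj (op n)) (z) :
    g • charMap (lift T v χ h σ) z = charMap (lift T v χ (g * h) σ) z :=
  toTop_map_charMap (translate T v χ g) (lift T v χ h σ) z

lemma charMap_lift_mem_orbit (h h' : H) {n : SimplexCategory} (σ : X.obj (op n)) (z) :
    charMap (lift T v χ h σ) z ∈ MulAction.orbit H (charMap (lift T v χ h' σ) z) :=
  MulAction.mem_orbit_iff.2 ⟨h * h'⁻¹, by rw [smul_charMap, inv_mul_cancel_right]⟩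

lemma proj_charMap (h : H) {n : SimplexCategory} (σ : X.obj (op n)) (z) :
    SSet.toTop.map (proj T v χ) (charMap (lift T v χ h σ) z) = charMap σ z :=
  toTop_map_charMap (proj T v χ) (lift T v χ h σ) z

lemma exists_charMap_lift_eq (y : SSet.toTop.obj (cover T v χ)) :
    ∃ (n : SimplexCategory) (h : H) (σ : X.obj (op n)) (z : _),
      charMap (lift T v χ h σ) z = y := by
  obtain ⟨n, x, z, rfl⟩ := exists_charMap_eq y
  exact ⟨n, x.1, x.2, z, rfl⟩

lemma proj_smul (g : H) (y : SSet.toTop.obj (cover T v χ)) :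
    SSet.toTop.map (proj T v χ) (g • y) = SSet.toTop.map (proj T v χ) y := by
  obtain ⟨n, h, σ, z, rfl⟩ := exists_charMap_lift_eq T v χ y
  rw [smul_charMap, proj_charMap, proj_charMap]

/-! ### The base as the space of orbits -/

/-- The inverse of the map from the space of orbits of the twisted simplicial set to the base. -/
def toOrbit : C(SSet.toTop.obj X,
    MulAction.orbitRel.Quotient H (SSet.toTop.obj (cover T v χ))) :=
  descend (fun n σ => .comp ⟨Quotient.mk _, continuous_quotient_mk'⟩
    (charMap (lift T v χ 1 σ))) fun m n f σ z => by
      -- The operator `f` turns the component `1` into the inverse of a value of `τ`; the two lifts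
      -- differ by a translation.
      refine Quotient.sound ?_
      change charMap (lift T v χ 1 (X.map f.op σ)) z ∈
        MulAction.orbit H (charMap (lift T v χ 1 σ) (stdSimplex.map f z))
      rw [← charMap_map, map_lift]
      exact charMap_lift_mem_orbit T v χ _ _ _ z

lemma toOrbit_proj (y : SSet.toTop.obj (cover T v χ)) :
    toOrbit T v χ (SSet.toTop.map (proj T v χ) y) = Quotient.mk _ y := by
  obtain ⟨n, h, σ, z, rfl⟩ := exists_charMap_lift_eq T v χ y
  rw [proj_charMap, toOrbit, descend_charMap]
  refine Quotient.sound ?_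
  change charMap (lift T v χ 1 σ) z ∈ MulAction.orbit H (charMap (lift T v χ h σ) z)
  exact charMap_lift_mem_orbit T v χ 1 h σ z

/-- The base of the twisted simplicial set is the space of orbits. -/
def orbitHomeo : MulAction.orbitRel.Quotient H (SSet.toTop.obj (cover T v χ)) ≃ₜ
    SSet.toTop.obj X where
  toFun := Quotient.lift (SSet.toTop.map (proj T v χ)) fun a b hab => by
    obtain ⟨g, rfl⟩ := MulAction.mem_orbit_iff.1 hab
    exact proj_smul T v χ g b
  invFun := toOrbit T v χ
  left_inv := by
    rintro ⟨y⟩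
    exact toOrbit_proj T v χ y
  right_inv x := by
    obtain ⟨n, σ, z, rfl⟩ := exists_charMap_eq x
    rw [toOrbit, descend_charMap]
    exact proj_charMap T v χ 1 σ z
  continuous_toFun := (continuous_toTop_map (proj T v χ)).quotient_lift _
  continuous_invFun := (toOrbit T v χ).continuous

lemma isQuotientMap_proj : IsQuotientMap (SSet.toTop.map (proj T v χ)) :=
  (orbitHomeo T v χ).isQuotientMap.comp isQuotientMap_quotient_mk'

lemma proj_eq_iff {y y' : SSet.toTop.obj (cover T v χ)} :
    SSet.toTop.map (proj T v χ) y = SSet.toTop.map (proj T v χ) y' ↔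
      y ∈ MulAction.orbit H y' := by
  constructor
  · intro h
    have := congrArg (toOrbit T v χ) h
    rw [toOrbit_proj, toOrbit_proj] at this
    exact Quotient.exact this
  · intro h
    obtain ⟨g, rfl⟩ := MulAction.mem_orbit_iff.1 h
    exact proj_smul T v χ g y'

/-! ### Translates of small open sets are disjoint -/

/-- The component in `H` of the `i`-th vertex of the simplex `(h, σ)`. -/
def label {n : SimplexCategory} (h : H) (σ : X.obj (op n)) (i : Fin (n.len + 1)) : H :=
  h * (tauEdge T v χ σ i (Fin.last _) (Fin.le_last _))⁻¹

/-- By the cocycle property of `τ`, a vertex has the same label in a simplex and in the faces and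
degeneracies that contain it. Hence sums over the vertices of one label descend to `|X̃|`. -/
lemma label_map {m n : SimplexCategory} (f : m ⟶ n) (h : H) (σ : X.obj (op n))
    (i : Fin (m.len + 1)) :
    label T v χ (h * (tauEdge T v χ σ (f.toOrderHom (Fin.last _)) (Fin.last _)
        (Fin.le_last _))⁻¹) (X.map f.op σ) i = label T v χ h σ (f.toOrderHom i) := by
  rw [label, label, tauEdge_map, mul_assoc, ← mul_inv_rev, ← tauEdge_trans]

open Classical in
lemma exists_mass_map (φ : C(ℝ, ℝ)) (k : H) : ∃ M : C(SSet.toTop.obj (cover T v χ), ℝ),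
    ∀ (n : SimplexCategory) (h : H) (σ : X.obj (op n)) (z),
      M (charMap (lift T v χ h σ) z) = ∑ i with label T v χ h σ i = k, mass φ z i := by
  obtain ⟨M, hM⟩ := exists_real_map (X := cover T v χ)
    (fun n x => ⟨fun z => ∑ i with label T v χ x.1 x.2 i = k, mass φ z i,
      continuous_finsetSum _ fun i _ => continuous_mass φ i⟩) fun m n f x z => by
        obtain ⟨h, σ, rfl⟩ := exists_lift T v χ x
        have hl := label_map T v χ f h σ
        change ∑ i with label T v χ (h * (tauEdge T v χ σ (f.toOrderHom (Fin.last _)) (Fin.last _)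
          (Fin.le_last _))⁻¹) (X.map f.op σ) i = k, mass φ z i =
            ∑ j with label T v χ h σ j = k, mass φ (stdSimplex.map f z) j
        simp only [hl, mass_map φ f f.toOrderHom.monotone]
        rw [Finset.sum_fiberwise_eq_sum_filter]
        simp
        rfl
  exact ⟨M, fun n h σ z => hM n (lift T v χ h σ) z⟩

open Classical in
lemma exists_nhds_disjoint (y : SSet.toTop.obj (cover T v χ)) :
    ∃ U ∈ 𝓝 y, ∀ g : H, ((g • ·) '' U ∩ U).Nonempty → g = 1 := by
  obtain ⟨n, h, σ, z, rfl⟩ := exists_charMap_lift_eq T v χ y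
  obtain ⟨i, hi⟩ : ∃ i, 0 < z i := by
    by_contra! hneg
    have h1 := stdSimplex.sum_eq_one z
    have h2 : ∑ i, z i ≤ 0 := Finset.sum_nonpos fun i _ => hneg i
    linarith
  set a := ∑ j ∈ Finset.Iio i, z j with ha
  have hb : ∑ j ∈ Finset.Iic i, z j = a + z i := by
    rw [← Finset.Iio_insert, Finset.sum_insert (by simp), add_comm]
  -- Clamping to the `i`-th interval `[a, a + z i]` of the given point: the total mass is at most `z
  -- i`, and at the given point the `i`-th vertex carries all of it.
  let φ : C(ℝ, ℝ) := ⟨fun t => max a (min t (a + z i)), by fun_prop⟩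
  have hφ : Monotone φ := fun s t hst => max_le_max le_rfl (min_le_min hst le_rfl)
  have hφi : mass φ z i = z i := by
    rw [mass, hb, ← ha]
    change max a (min (a + z i) (a + z i)) - max a (min a (a + z i)) = z i
    rw [min_self, max_eq_right (by linarith), min_eq_left (by linarith), max_self]
    ring
  have htot : φ 1 - φ 0 ≤ z i := by
    have h1 : φ 1 ≤ a + z i := max_le (by linarith) (min_le_right _ _)
    have h0 : a ≤ φ 0 := le_max_left _ _
    linarith
  set k := label T v χ h σ i with hk
  obtain ⟨M, hM⟩ := exists_mass_map T v χ φ k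
  -- The threshold is half of the bound on the total mass, so two disjoint sets of vertices cannot
  -- both exceed it.
  refine ⟨M ⁻¹' Set.Ioi (z i / 2), ?_, ?_⟩
  · refine (isOpen_Ioi.preimage M.continuous).mem_nhds ?_
    rw [Set.mem_preimage, hM, Set.mem_Ioi]
    have : mass φ z i ≤ ∑ j with label T v χ h σ j = k, mass φ z j :=
      Finset.single_le_sum (fun j _ => mass_nonneg hφ z j) (by simp [hk])
    linarith
  · rintro g ⟨_, ⟨y, hy, rfl⟩, hy'⟩
    obtain ⟨m, h', τ, w, rfl⟩ := exists_charMap_lift_eq T v χ y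
    simp only [smul_charMap, Set.mem_preimage, hM, Set.mem_Ioi] at hy hy'
    by_contra hg
    -- Translation by `g` multiplies labels by `g`, so for `g ≠ 1` no vertex has label `k` both
    -- before and after translation.
    have hdisj : Disjoint (Finset.univ.filter fun j => label T v χ h' τ j = k)
        (Finset.univ.filter fun j => label T v χ (g * h') τ j = k) := by
      rw [Finset.disjoint_filter]
      intro j _ h1 h2
      rw [label, mul_assoc] at h2
      rw [label] at h1
      rw [h1] at h2
      exact hg (mul_eq_right.1 h2)
    have hle := Finset.sum_le_sum_of_subset_of_nonneg (Finset.subset_univ _)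
      (fun j _ _ => mass_nonneg hφ w j) (s := (Finset.univ.filter fun j => label T v χ h' τ j = k) ∪
        (Finset.univ.filter fun j => label T v χ (g * h') τ j = k))
    rw [Finset.sum_union hdisj, sum_mass] at hle
    linarith

theorem isQuotientCoveringMap_proj : IsQuotientCoveringMap (SSet.toTop.map (proj T v χ)) H where
  __ := isQuotientMap_proj T v χ
  continuous_const_smul := continuous_const_smul
  apply_eq_iff_mem_orbit := proj_eq_iff T v χ
  disjoint := exists_nhds_disjoint T v χ

end Covering

/-! ### Supports of points of the standard simplices -/

lemma map_apply_pos_iff {ι κ : Type*} [Fintype ι] [Fintype κ] (f : ι → κ)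
    (z : stdSimplex ℝ ι) (j : κ) : 0 < stdSimplex.map f z j ↔ ∃ i, f i = j ∧ 0 < z i := by
  classical
  rw [stdSimplex.map_coe, FunOnFinite.linearMap_apply_apply,
    Finset.sum_pos_iff_of_nonneg fun i _ => stdSimplex.zero_le z i]
  simp

lemma map_apply_of_injective {ι κ : Type*} [Fintype ι] [Fintype κ] {f : ι → κ}
    (hf : Function.Injective f) (z : stdSimplex ℝ ι) (i : ι) : stdSimplex.map f z (f i) = z i := by
  classical
  rw [stdSimplex.map_coe, FunOnFinite.linearMap_apply_apply, Finset.sum_eq_single i]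
  · intro j hj hji
    exact absurd (hf (by simpa using hj)) hji
  · simp

lemma stdSimplex_map_injective {ι κ : Type*} [Fintype ι] [Fintype κ] {f : ι → κ}
    (hf : Function.Injective f) : Function.Injective (stdSimplex.map (S := ℝ) f) := by
  intro z w h
  ext i
  rw [← map_apply_of_injective hf z i, h, map_apply_of_injective hf]

lemma hom_injective {m n : SimplexCategory} (d : m ⟶ n) [Mono d] : Function.Injective d :=
  SimplexCategory.mono_iff_injective.1 inferInstance

lemma map_comp_hom {k m n : SimplexCategory} (f : k ⟶ m) (g : m ⟶ n)
    (z : stdSimplex ℝ (Fin (k.len + 1))) :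
    stdSimplex.map (f ≫ g) z = stdSimplex.map g (stdSimplex.map f z) := by
  rw [stdSimplex.map_comp_apply]
  rfl

lemma map_id_hom {n : SimplexCategory} (z : stdSimplex ℝ (Fin (n.len + 1))) :
    stdSimplex.map (𝟙 n : n ⟶ n) z = z :=
  stdSimplex.map_id_apply z

/-- Every point of a standard simplex lies in the interior of a face. -/
lemma exists_mono_map_eq {n : SimplexCategory} (z : stdSimplex ℝ (Fin (n.len + 1))) :
    ∃ (k : SimplexCategory) (d : k ⟶ n) (w : stdSimplex ℝ (Fin (k.len + 1))),
      Mono d ∧ (∀ i, 0 < w i) ∧ stdSimplex.map d w = z := by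
  classical
  let S : Finset (Fin (n.len + 1)) := {i | 0 < z i}
  have hsum : ∑ i ∈ S, z i = 1 := by
    rw [← stdSimplex.sum_eq_one z]
    refine Finset.sum_subset (Finset.subset_univ _) fun i _ hi => ?_
    simp only [S, Finset.mem_filter, Finset.mem_univ, true_and, not_lt] at hi
    exact le_antisymm hi (stdSimplex.zero_le z i)
  have hne : S.Nonempty := by
    by_contra h
    rw [Finset.not_nonempty_iff_eq_empty] at h
    simp [h] at hsum
  have hcard : S.card = (S.card - 1) + 1 := (Nat.succ_pred_eq_of_pos hne.card_pos).symm
  let e := S.orderEmbOfFin hcard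
  let d : (⦋S.card - 1⦌ : SimplexCategory) ⟶ n := SimplexCategory.Hom.mk e.toOrderHom
  have hd : Function.Injective d := e.injective
  have hrange : Finset.univ.image e = S := by simp [e]
  let w : stdSimplex ℝ (Fin (S.card - 1 + 1)) := ⟨fun i => z (e i), fun i => stdSimplex.zero_le z _, by
    rw [← hsum]
    conv_rhs => rw [← hrange]
    rw [Finset.sum_image fun i _ j _ h => e.injective h]⟩
  have hpos : ∀ i, 0 < w i := fun i => by
    have : e i ∈ S := Finset.orderEmbOfFin_mem S hcard i
    change 0 < z (e i)
    simpa [S] using this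
  refine ⟨_, d, w, SimplexCategory.mono_iff_injective.2 hd, hpos, ?_⟩
  ext j
  by_cases hj : j ∈ S
  · rw [← hrange] at hj
    obtain ⟨i, -, rfl⟩ := Finset.mem_image.1 hj
    exact map_apply_of_injective hd w i
  · have h1 : ¬ 0 < z j := by simpa [S] using hj
    have h2 : ¬ 0 < stdSimplex.map d w j := by
      rw [map_apply_pos_iff]
      rintro ⟨i, rfl, -⟩
      exact hj (Finset.orderEmbOfFin_mem S hcard i)
    exact (le_antisymm (not_lt.1 h2) (stdSimplex.zero_le _ j)).trans
      (le_antisymm (not_lt.1 h1) (stdSimplex.zero_le z j)).symm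

lemma exists_factor_of_range_subset {k l n : SimplexCategory} (f : k ⟶ n) (d : l ⟶ n) [Mono d]
    (h : ∀ i, ∃ j, d j = f i) : ∃ g : k ⟶ l, g ≫ d = f := by
  choose g hg using h
  have hd : StrictMono d :=
    d.toOrderHom.monotone.strictMono_of_injective (hom_injective d)
  refine ⟨SimplexCategory.Hom.mk ⟨g, fun i j hij => hd.le_iff_le.1 ?_⟩, ?_⟩
  · rw [hg, hg]
    exact f.toOrderHom.monotone hij
  · ext i : 3
    exact hg i

lemma exists_epi_mono_factor {m n : SimplexCategory} (f : m ⟶ n) :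
    ∃ (k : SimplexCategory) (e : m ⟶ k) (d : k ⟶ n) (s : k ⟶ m),
      Epi e ∧ Mono d ∧ e ≫ d = f ∧ s ≫ e = 𝟙 k := by
  have := isSplitEpi_of_epi (Limits.factorThruImage f)
  exact ⟨_, Limits.factorThruImage f, Limits.image.ι f, section_ (Limits.factorThruImage f),
    inferInstance, inferInstance, Limits.image.fac f, IsSplitEpi.id _⟩

lemma map_op_comp_apply {X : SSet.{u}} {k m n : SimplexCategory} (f : k ⟶ m) (g : m ⟶ n)
    (σ : X.obj (op n)) : X.map (f ≫ g).op σ = X.map f.op (X.map g.op σ) := by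
  rw [op_comp, Functor.map_comp_apply]

lemma map_op_id_apply {X : SSet.{u}} {n : SimplexCategory} (σ : X.obj (op n)) :
    X.map (𝟙 n : n ⟶ n).op σ = σ := by
  simp

/-- If a point of `|X|` in the interior of a simplex `σ` comes from `|A|` for a simplicial subset
`A`, then `σ` and the point of the simplex come from `A`. -/
lemma exists_mono_of_charMap_eq {A X : SSet.{u}} (i : A ⟶ X) [Mono i] {m n : SimplexCategory}
    {σ : X.obj (op m)} {τ : A.obj (op n)} {z : stdSimplex ℝ (Fin (m.len + 1))}
    {w : stdSimplex ℝ (Fin (n.len + 1))} (h : charMap σ z = charMap (i.app _ τ) w) :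
    ∃ (k : SimplexCategory) (d : k ⟶ m) (ρ : A.obj (op k)) (z' : stdSimplex ℝ (Fin (k.len + 1))),
      Mono d ∧ i.app _ ρ = X.map d.op σ ∧ stdSimplex.map d z' = z ∧
        charMap ρ z' = charMap τ w := by
  have hi : ∀ k : SimplexCategory, Function.Injective (i.app (op k)) := fun k =>
    (mono_iff_injective _).1 inferInstance
  refine (iff_of_charMap_eq (X := X) (fun m σ z => ∃ (k : SimplexCategory) (d : k ⟶ m)
    (ρ : A.obj (op k)) (z' : stdSimplex ℝ (Fin (k.len + 1))),
      Mono d ∧ i.app _ ρ = X.map d.op σ ∧ stdSimplex.map d z' = z ∧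
        charMap ρ z' = charMap τ w) ?_ h).2 ?_
  · intro p m f σ z
    constructor
    · rintro ⟨k, d, ρ, z', hd, h1, rfl, h2⟩
      -- `A` may be smaller than `X`, but it is closed under operators: the face `c^* σ` is the
      -- pullback along the section `s` of a simplex of `A`, hence lies in `A`.
      obtain ⟨l, e, c, s, he, hc, hf, hs⟩ := exists_epi_mono_factor (d ≫ f)
      have hσ : X.map e.op (X.map c.op σ) = i.app _ ρ := by
        rw [h1, ← map_op_comp_apply, hf, map_op_comp_apply]
      have h3 : i.app _ (A.map s.op ρ) = X.map c.op σ := by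
        rw [NatTrans.naturality_apply, ← hσ, ← map_op_comp_apply s, hs, map_op_id_apply]
      have h4 : A.map e.op (A.map s.op ρ) = ρ := by
        apply hi
        rw [NatTrans.naturality_apply, h3, hσ]
      refine ⟨l, c, A.map s.op ρ, stdSimplex.map e z', hc, h3, ?_, ?_⟩
      · rw [← map_comp_hom, hf, map_comp_hom]
      · rw [← h2, ← charMap_map, h4]
    · rintro ⟨k, d, ρ, z', hd, h1, h2, h3⟩
      -- On the face that contains `z` in its interior, `f` takes only values in the support of the
      -- image point, which lies in the range of `d`; so `c ≫ f` factors through `d`.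
      obtain ⟨l, c, w', hc, hw', rfl⟩ := exists_mono_map_eq z
      obtain ⟨g, hg⟩ := exists_factor_of_range_subset (c ≫ f) d fun j => by
        have : 0 < stdSimplex.map d z' ((c ≫ f) j) := by
          rw [h2, ← map_comp_hom, map_apply_pos_iff]
          exact ⟨j, rfl, hw' j⟩
        obtain ⟨j', hj', -⟩ := (map_apply_pos_iff _ _ _).1 this
        exact ⟨j', hj'⟩
      refine ⟨l, c, A.map g.op ρ, w', hc, ?_, rfl, ?_⟩
      · rw [NatTrans.naturality_apply, h1, ← map_op_comp_apply, ← map_op_comp_apply, hg]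
      · rw [charMap_map, ← h3]
        congr 1
        apply stdSimplex_map_injective (hom_injective d)
        rw [h2, ← map_comp_hom, ← map_comp_hom, hg]
  · exact ⟨n, 𝟙 n, τ, w, inferInstance, (map_op_id_apply _).symm, map_id_hom w, rfl⟩

/-! ### Realizations of simplicial subsets are closed subspaces. -/

lemma toTop_map_injective {A X : SSet.{u}} (i : A ⟶ X) [Mono i] :
    Function.Injective (SSet.toTop.map i) := by
  intro x y hxy
  obtain ⟨m, σ, z, rfl⟩ := exists_charMap_eq x
  obtain ⟨n, τ, w, rfl⟩ := exists_charMap_eq y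
  rw [toTop_map_charMap, toTop_map_charMap] at hxy
  obtain ⟨k, d, ρ, z', -, h1, rfl, h2⟩ := exists_mono_of_charMap_eq i hxy
  have hρ : ρ = A.map d.op σ := by
    apply (mono_iff_injective (i.app (op k))).1 inferInstance
    rw [h1, NatTrans.naturality_apply]
  rw [← h2, ← charMap_map, hρ]

/-- A subset of `|X|` is closed if on every simplex it agrees on the interior with a closed set. -/
lemma isClosed_of_interior {X : SSet.{u}} {C : Set (SSet.toTop.obj X)}
    (D : ∀ n : SimplexCategory, X.obj (op n) → Set (stdSimplex ℝ (Fin (n.len + 1))))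
    (hD : ∀ n σ, IsClosed (D n σ)) (hDC : ∀ n σ, ∀ z ∈ D n σ, charMap σ z ∈ C)
    (hCD : ∀ n σ z, (∀ i, 0 < z i) → charMap σ z ∈ C → z ∈ D n σ) : IsClosed C := by
  rw [isClosed_iff_charMap]
  intro n σ
  -- Each point is interior to a face, whose dimension is at most that of `σ`. This makes the
  -- preimage a finite union of images of compact sets.
  have : charMap σ ⁻¹' C = ⋃ (k : Fin (n.len + 1)) (d : ⦋(k : ℕ)⦌ ⟶ n),
      stdSimplex.map d '' D ⦋(k : ℕ)⦌ (X.map d.op σ) := by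
    ext z
    simp only [Set.mem_preimage, Set.mem_iUnion]
    constructor
    · intro hz
      obtain ⟨k, d, w, hd, hw, rfl⟩ := exists_mono_map_eq z
      exact ⟨⟨k.len, Nat.lt_succ_of_le (SimplexCategory.len_le_of_mono d)⟩, d, w,
        hCD _ _ w hw (by rwa [charMap_map]), rfl⟩
    · rintro ⟨k, d, w, hw, rfl⟩
      rw [← charMap_map]
      exact hDC ⦋(k : ℕ)⦌ (X.map d.op σ) w hw
  rw [this]
  have hcomp : ∀ m, CompactSpace (stdSimplex ℝ (Fin m)) := fun m =>
    isCompact_iff_compactSpace.1 (isCompact_stdSimplex ℝ (Fin m))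
  exact isClosed_iUnion_of_finite fun k => isClosed_iUnion_of_finite fun d =>
    ((hD _ _).isCompact.image (stdSimplex.continuous_map _)).isClosed

/-- If an interior point of `σ` comes from `|A|`, then the face supplied by
`exists_mono_of_charMap_eq` is all of `σ`, so `σ` is in `A`. On the interior of `σ` the image of a
closed set is therefore the trace of a closed set when `σ` comes from `A`, and empty otherwise. -/
lemma isClosedEmbedding_toTop_map {A X : SSet.{u}} (i : A ⟶ X) [Mono i] :
    IsClosedEmbedding (SSet.toTop.map i) := by
  refine .of_continuous_injective_isClosedMap (continuous_toTop_map i) (toTop_map_injective i) ?_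
  intro C hC
  refine isClosed_of_interior
    (fun n σ => {z | ∃ ρ : A.obj (op n), i.app _ ρ = σ ∧ charMap ρ z ∈ C}) ?_ ?_ ?_
  · intro n σ
    by_cases hσ : ∃ ρ : A.obj (op n), i.app _ ρ = σ
    · obtain ⟨ρ, rfl⟩ := hσ
      have hi : Function.Injective (i.app (op n)) := (mono_iff_injective _).1 inferInstance
      convert hC.preimage (charMap ρ).continuous using 1
      ext z
      constructor
      · rintro ⟨ρ', h, hz⟩
        rwa [hi h] at hz
      · exact fun hz => ⟨ρ, rfl, hz⟩
    · convert isClosed_empty using 1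
      ext z
      exact ⟨fun ⟨ρ, h, _⟩ => hσ ⟨ρ, h⟩, fun h => h.elim⟩
  · rintro n _ z ⟨ρ, rfl, hz⟩
    exact ⟨_, hz, toTop_map_charMap i ρ z⟩
  · rintro n σ z hz ⟨x, hx, hxz⟩
    obtain ⟨m, τ, w, rfl⟩ := exists_charMap_eq x
    rw [toTop_map_charMap] at hxz
    obtain ⟨k, d, ρ, z', hd, h1, rfl, h2⟩ := exists_mono_of_charMap_eq i hxz.symm
    have hsurj : Function.Surjective d := fun j => by
      obtain ⟨j', h, -⟩ := (map_apply_pos_iff _ _ _).1 (hz j)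
      exact ⟨j', h⟩
    have : IsIso d := SimplexCategory.isIso_of_bijective
      ⟨hom_injective d, hsurj⟩
    refine ⟨A.map (inv d).op ρ, ?_, ?_⟩
    · rw [NatTrans.naturality_apply, h1, ← map_op_comp_apply, IsIso.inv_hom_id, map_op_id_apply]
    · rw [charMap_map, ← map_comp_hom, IsIso.hom_inv_id, map_id_hom, h2]
      exact hx

/-! ### Maps out of the realization of a finite-dimensional simplicial set -/

lemma not_surjective_of_apply_eq_zero {ι κ : Type*} [Fintype ι] [Fintype κ] {f : ι → κ}
    (hf : ¬ Function.Surjective f) (z : stdSimplex ℝ ι) : ∃ j, stdSimplex.map f z j = 0 := by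
  rw [Function.Surjective] at hf
  push Not at hf
  obtain ⟨j, hj⟩ := hf
  refine ⟨j, le_antisymm (not_lt.1 fun h => ?_) (stdSimplex.zero_le _ j)⟩
  obtain ⟨i, hi, -⟩ := (map_apply_pos_iff f z j).1 h
  exact hj i hi

/-- A section of `e` would present `τ` as a pullback of the lower-dimensional `ρ`. -/
lemma not_epi_pullback_of_lt {Y : SSet.{u}} {k n : ℕ} (hkn : k < n) {m : SimplexCategory}
    (f : m ⟶ ⦋k⦌) (ρ : Y _⦋k⦌) (e : m ⟶ ⦋n⦌) [Epi e] (τ : Y _⦋n⦌) (hτ : τ ∈ Y.nonDegenerate n) :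
    Y.map f.op ρ ≠ Y.map e.op τ := by
  intro h
  have := isSplitEpi_of_epi e
  refine hτ ⟨k, hkn, section_ e ≫ f, ρ, ?_⟩
  rw [map_op_comp_apply, h, ← map_op_comp_apply, IsSplitEpi.id, map_op_id_apply]

lemma exists_lt_of_not_epi {m : SimplexCategory} {n : ℕ} (f : m ⟶ ⦋n⦌) (hf : ¬ Epi f) :
    ∃ (k : ℕ) (_ : k < n) (e : m ⟶ ⦋k⦌) (d : ⦋k⦌ ⟶ ⦋n⦌), e ≫ d = f := by
  obtain ⟨k, e, d, -, he, hd, h, -⟩ := exists_epi_mono_factor f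
  refine ⟨k.len, lt_of_le_of_ne (SimplexCategory.len_le_of_mono d) fun hk => hf ?_, e, d, h⟩
  have : IsIso d := (SimplexCategory.isIso_iff_of_mono d).2 hk
  rw [← h]
  infer_instance

section Extension

variable {Y : SSet.{u}} {n : ℕ} {Z : Type u} [TopologicalSpace Z]
  (b : C(SSet.toTop.obj Y, Z)) (g : Y _⦋n⦌ → C(stdSimplex ℝ (Fin (n + 1)), Z))

open Classical in
/-- The map on a simplex which is given by `g` on pullbacks of nondegenerate `n`-simplices along
degeneracy operators, and by `b` on all other simplices. -/
def extendOn {m : SimplexCategory} (σ : Y.obj (op m)) : C(stdSimplex ℝ (Fin (m.len + 1)), Z) :=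
  if h : ∃ (e : m ⟶ ⦋n⦌) (τ : Y _⦋n⦌), Epi e ∧ τ ∈ Y.nonDegenerate n ∧ σ = Y.map e.op τ then
    (g h.choose_spec.choose).comp ⟨_, stdSimplex.continuous_map h.choose⟩
  else b.comp (charMap σ)

lemma extendOn_epi {m : SimplexCategory} (e : m ⟶ ⦋n⦌) [Epi e] (τ : Y _⦋n⦌)
    (hτ : τ ∈ Y.nonDegenerate n) (z : stdSimplex ℝ (Fin (m.len + 1))) :
    extendOn b g (Y.map e.op τ) z = g τ (stdSimplex.map e z) := by
  have h : ∃ (e' : m ⟶ ⦋n⦌) (τ' : Y _⦋n⦌), Epi e' ∧ τ' ∈ Y.nonDegenerate n ∧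
    Y.map e.op τ = Y.map e'.op τ' := ⟨e, τ, inferInstance, hτ, rfl⟩
  obtain ⟨h1, h2, h3⟩ := h.choose_spec.choose_spec
  induction m using SimplexCategory.rec with | _ m
  -- Eilenberg–Zilber: a simplex determines its degeneracy operator and its nondegenerate simplex,
  -- so the choices made in `extendOn` are `e` and `τ`.
  have hs := Y.unique_nonDegenerate_simplex _ e ⟨τ, hτ⟩ rfl h.choose ⟨_, h2⟩ h3
  have hm := Y.unique_nonDegenerate_map _ e ⟨τ, hτ⟩ rfl h.choose ⟨_, h2⟩ h3
  rw [extendOn, dif_pos h]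
  rw [Subtype.mk.injEq] at hs
  change g h.choose_spec.choose (stdSimplex.map h.choose z) = _
  rw [← hs, ← hm]

lemma extendOn_of_lt {m : SimplexCategory} {k : ℕ} (hk : k < n) (f : m ⟶ ⦋k⦌) (ρ : Y _⦋k⦌)
    (z : stdSimplex ℝ (Fin (m.len + 1))) :
    extendOn b g (Y.map f.op ρ) z = b (charMap (Y.map f.op ρ) z) := by
  rw [extendOn, dif_neg]
  · rfl
  · rintro ⟨e, τ, he, hτ, h⟩
    exact not_epi_pullback_of_lt hk f ρ e τ hτ h

/-- If `Y` has dimension at most `n`, a map on `|Y|` can be changed on the nondegenerate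
`n`-simplices as long as it stays the same on their boundaries. -/
lemma exists_extension [Y.HasDimensionLT (n + 1)]
    (hg : ∀ τ ∈ Y.nonDegenerate n, ∀ z, (∃ i, z i = 0) → g τ z = b (charMap (n := ⦋n⦌) τ z)) :
    ∃ G : C(SSet.toTop.obj Y, Z),
      (∀ τ ∈ Y.nonDegenerate n, ∀ z, G (charMap (n := ⦋n⦌) τ z) = g τ z) ∧
      ∀ k < n, ∀ (ρ : Y _⦋k⦌) (z), G (charMap (n := ⦋k⦌) ρ z) = b (charMap (n := ⦋k⦌) ρ z) := by
  refine ⟨descend (fun m σ => extendOn b g σ) ?_, ?_, ?_⟩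
  · intro p m f σ z
    induction m using SimplexCategory.rec with | _ m
    obtain ⟨k, e, he, ⟨τ, hτ⟩, rfl⟩ := Y.exists_nonDegenerate σ
    have hk : k ≤ n := Y.dim_le_of_nonDegenerate ⟨τ, hτ⟩ n
    change extendOn b g (Y.map f.op (Y.map e.op τ)) z =
      extendOn b g (Y.map e.op τ) (stdSimplex.map f z)
    rw [← map_op_comp_apply]
    obtain hk | rfl := hk.lt_or_eq
    · rw [extendOn_of_lt b g hk, extendOn_of_lt b g hk, map_op_comp_apply, charMap_map]
    · rw [extendOn_epi b g e τ hτ, ← map_comp_hom]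
      by_cases hf : Epi (f ≫ e)
      · rw [extendOn_epi b g (f ≫ e) τ hτ]
      -- If `f ≫ e` is not epi, the point is on the boundary of `τ`, where `g` equals `b`, and the
      -- pulled back simplex comes from a lower dimension, where `b` is used.
      · refine Eq.trans ?_ (hg τ hτ _ (not_surjective_of_apply_eq_zero
          (fun h => hf (SimplexCategory.epi_iff_surjective.2 h)) z)).symm
        obtain ⟨l, hl, e', d, h⟩ := exists_lt_of_not_epi (f ≫ e) hf
        refine Eq.trans ?_ (congrArg b (charMap_map (f ≫ e) τ z))
        rw [← h, map_op_comp_apply, extendOn_of_lt b g hl]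
  · intro τ hτ z
    have h := extendOn_epi b g (𝟙 ⦋n⦌) τ hτ z
    rw [map_id_hom, map_op_id_apply] at h
    exact (descend_charMap _ _ _ _).trans h
  · intro k hk ρ z
    have h := extendOn_of_lt b g hk (𝟙 ⦋k⦌) ρ z
    rw [map_op_id_apply] at h
    exact (descend_charMap _ _ _ _).trans h

end Extension

lemma exists_face_of_apply_eq_zero {Y : SSet.{u}} {n : ℕ} (τ : Y _⦋n⦌)
    {z : stdSimplex ℝ (Fin (n + 1))} (hz : ∃ i, z i = 0) :
    ∃ k < n, ∃ (ρ : Y _⦋k⦌) (w : _), charMap (n := ⦋k⦌) ρ w = charMap (n := ⦋n⦌) τ z := by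
  obtain ⟨l, d, w, hd, hw, rfl⟩ := exists_mono_map_eq (n := ⦋n⦌) z
  refine ⟨l.len, lt_of_le_of_ne (SimplexCategory.len_le_of_mono d) fun h => ?_,
    Y.map d.op τ, w, charMap_map d τ w⟩
  have : IsIso d := (SimplexCategory.isIso_iff_of_mono d).2 h
  obtain ⟨i, hi⟩ := hz
  obtain ⟨j, hj⟩ := SimplexCategory.epi_iff_surjective.1 (inferInstance : Epi d) i
  exact ((map_apply_pos_iff d w i).2 ⟨j, hj, hw j⟩).ne' hi

/-- A point in the realization of a simplicial set of dimension at most `n` lies on a simplex of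
smaller dimension or in the interior of a nondegenerate `n`-simplex. -/
lemma exists_lt_or_interior {Y : SSet.{u}} {n : ℕ} [Y.HasDimensionLT (n + 1)]
    (x : SSet.toTop.obj Y) :
    (∃ k < n, ∃ (ρ : Y _⦋k⦌) (z : _), charMap (n := ⦋k⦌) ρ z = x) ∨
      ∃ τ ∈ Y.nonDegenerate n, ∃ z : stdSimplex ℝ (Fin (n + 1)),
        (∀ i, 0 < z i) ∧ charMap (n := ⦋n⦌) τ z = x := by
  obtain ⟨m, σ, z, rfl⟩ := exists_charMap_eq x
  induction m using SimplexCategory.rec with | _ m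
  obtain ⟨k, e, he, ⟨τ, hτ⟩, rfl⟩ := Y.exists_nonDegenerate σ
  change (∃ k < n, ∃ (ρ : Y _⦋k⦌) (w : _), charMap (n := ⦋k⦌) ρ w = charMap (Y.map e.op τ) z) ∨
    ∃ τ' ∈ Y.nonDegenerate n, ∃ w : stdSimplex ℝ (Fin (n + 1)), (∀ i, 0 < w i) ∧
      charMap (n := ⦋n⦌) τ' w = charMap (Y.map e.op τ) z
  rw [charMap_map]
  generalize stdSimplex.map e z = w
  have hk : k ≤ n := Y.dim_le_of_nonDegenerate ⟨τ, hτ⟩ n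
  obtain hk | rfl := hk.lt_or_eq
  · exact Or.inl ⟨k, hk, τ, w, rfl⟩
  · by_cases hw : ∀ i, 0 < w i
    · exact Or.inr ⟨τ, hτ, w, hw, rfl⟩
    · push Not at hw
      obtain ⟨i, hi⟩ := hw
      exact Or.inl (exists_face_of_apply_eq_zero τ ⟨i, le_antisymm hi (stdSimplex.zero_le w i)⟩)

/-- The smallest barycentric coordinate. -/
def minCoord {n : ℕ} (z : stdSimplex ℝ (Fin (n + 1))) : ℝ :=
  Finset.univ.inf' Finset.univ_nonempty z

lemma continuous_minCoord {n : ℕ} :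
    Continuous (minCoord : stdSimplex ℝ (Fin (n + 1)) → ℝ) :=
  Continuous.finset_inf'_apply _ fun i _ => continuous_coord i

lemma minCoord_le {n : ℕ} (z : stdSimplex ℝ (Fin (n + 1))) (i : Fin (n + 1)) :
    minCoord z ≤ z i :=
  Finset.inf'_le _ (Finset.mem_univ i)

lemma minCoord_nonneg {n : ℕ} (z : stdSimplex ℝ (Fin (n + 1))) : 0 ≤ minCoord z :=
  Finset.le_inf' _ _ fun i _ => stdSimplex.zero_le z i

lemma exists_eq_minCoord {n : ℕ} (z : stdSimplex ℝ (Fin (n + 1))) : ∃ i, z i = minCoord z := by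
  obtain ⟨i, -, hi⟩ := Finset.exists_mem_eq_inf' Finset.univ_nonempty z
  exact ⟨i, hi.symm⟩

lemma minCoord_pos {n : ℕ} {z : stdSimplex ℝ (Fin (n + 1))} (hz : ∀ i, 0 < z i) :
    0 < minCoord z := by
  obtain ⟨i, hi⟩ := exists_eq_minCoord z
  exact hi ▸ hz i

lemma minCoord_eq_zero {n : ℕ} {z : stdSimplex ℝ (Fin (n + 1))} (hz : ∃ i, z i = 0) :
    minCoord z = 0 := by
  obtain ⟨i, hi⟩ := hz
  exact le_antisymm (hi ▸ minCoord_le z i) (minCoord_nonneg z)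

open Classical in
/-- Coordinates on an open cell of top dimension, extended by zero. -/
lemma exists_cell_coords {Y : SSet.{u}} {n : ℕ} [Y.HasDimensionLT (n + 1)] {τ : Y _⦋n⦌}
    (hτ : τ ∈ Y.nonDegenerate n) :
    ∃ G : C(SSet.toTop.obj Y, Fin (n + 1) → ℝ),
      (∀ z i, G (charMap (n := ⦋n⦌) τ z) i = minCoord z * z i) ∧
      ∀ x, G x ≠ 0 → ∃ z : stdSimplex ℝ (Fin (n + 1)),
        (∀ i, 0 < z i) ∧ charMap (n := ⦋n⦌) τ z = x := by
  -- The factor `minCoord z` makes the coordinates vanish on the boundary, so that they extend by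
  -- zero. It is also their sum, so division recovers `z` on the interior.
  let c : C(stdSimplex ℝ (Fin (n + 1)), Fin (n + 1) → ℝ) :=
    ⟨fun z i => minCoord z * z i,
      continuous_pi fun i => continuous_minCoord.mul (continuous_coord i)⟩
  obtain ⟨G, hG, hG'⟩ := exists_extension (Y := Y) (n := n) (Z := ULift.{u} (Fin (n + 1) → ℝ))
    (.const _ ⟨0⟩)
    (fun τ' => if τ' = τ then (⟨ULift.up, continuous_uliftUp⟩ : C(_, _)).comp c else .const _ ⟨0⟩)
    (by
      intro τ' _ z hz
      split_ifs
      · refine congrArg ULift.up (funext fun i => ?_)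
        change minCoord z * z i = 0
        rw [minCoord_eq_zero hz, zero_mul]
      · rfl)
  refine ⟨.comp ⟨ULift.down, continuous_uliftDown⟩ G, fun z i => ?_, fun x hx => ?_⟩
  · have := hG τ hτ z
    rw [if_pos rfl] at this
    exact congrFun (congrArg ULift.down this) i
  · obtain ⟨k, hk, ρ, z, rfl⟩ | ⟨τ', hτ', z, hz, rfl⟩ := exists_lt_or_interior (n := n) x
    · exact absurd (congrArg ULift.down (hG' k hk ρ z)) hx
    · by_cases h : τ' = τ
      · subst h
        exact ⟨z, hz, rfl⟩
      · have := hG τ' hτ' z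
        rw [if_neg h] at this
        exact absurd (congrArg ULift.down this) hx

/-! ### Skeleta, and closedness of points. -/

lemma mem_range_skeleton {X : SSet.{u}} {k n : ℕ} (hk : k < n) (ρ : X _⦋k⦌) (z) :
    charMap (n := ⦋k⦌) ρ z ∈ Set.range (SSet.toTop.map (X.skeleton n).ι) :=
  ⟨charMap (n := ⦋k⦌) (X := (X.skeleton n).toSSet) ⟨ρ, X.mem_skeleton ρ hk⟩ z,
    toTop_map_charMap _ _ _⟩

lemma hasDimensionLT_skeleton (X : SSet.{u}) (n : ℕ) :
    (X.skeleton n).toSSet.HasDimensionLT n where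
  degenerate_eq_top k hk := by
    ext x
    simp only [Set.top_eq_univ, Set.mem_univ, iff_true]
    by_contra h
    have h1 : x ∈ (X.skeleton n).toSSet.nonDegenerate k := h
    have h2 := ((X.skeleton n).mem_nonDegenerate_iff x).1 h1
    have := (X.mem_skeleton_obj_iff_of_nonDegenerate ⟨x.1, h2⟩ n).1 x.2
    lia

lemma isEmpty_of_hasDimensionLT_zero (Y : SSet.{u}) [Y.HasDimensionLT 0] :
    IsEmpty (SSet.toTop.obj Y) where
  false x := by
    obtain ⟨m, σ, z, rfl⟩ := exists_charMap_eq x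
    induction m using SimplexCategory.rec with | _ m
    obtain ⟨k, e, he, τ, rfl⟩ := Y.exists_nonDegenerate σ
    exact absurd (Y.dim_lt_of_nonDegenerate τ 0) (by lia)

/-- Induction on dimension: a point lies in a lower skeleton, which is closed, or in an open top
cell, where it is a fibre of the cell coordinates. -/
lemma t1Space_of_hasDimensionLT (n : ℕ) (Y : SSet.{u}) [Y.HasDimensionLT n] :
    T1Space (SSet.toTop.obj Y) := by
  induction n generalizing Y with
  | zero =>
    have := isEmpty_of_hasDimensionLT_zero Y
    exact ⟨fun x => this.elim x⟩
  | succ n ih =>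
    refine ⟨fun x => ?_⟩
    obtain ⟨k, hk, ρ, z, rfl⟩ | ⟨τ, hτ, z, hz, rfl⟩ := exists_lt_or_interior (n := n) x
    · have := hasDimensionLT_skeleton Y n
      have := ih (Y.skeleton n).toSSet
      obtain ⟨y, hy⟩ := mem_range_skeleton hk ρ z
      rw [← hy, ← Set.image_singleton]
      exact (isClosedEmbedding_toTop_map (Y.skeleton n).ι).isClosedMap _ isClosed_singleton
    · obtain ⟨G, hG, hG'⟩ := exists_cell_coords hτ
      have hsum : ∀ w : stdSimplex ℝ (Fin (n + 1)),
          ∑ i, G (charMap (n := ⦋n⦌) τ w) i = minCoord w := fun w => by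
        simp only [hG]
        rw [← Finset.mul_sum, stdSimplex.sum_eq_one, mul_one]
      convert isClosed_singleton (x := G (charMap (n := ⦋n⦌) τ z)) |>.preimage G.continuous using 1
      ext y
      refine ⟨by rintro rfl; rfl, fun hy => ?_⟩
      have hpos := minCoord_pos hz
      have hne : G y ≠ 0 := by
        intro h0
        have h1 := hsum z
        rw [← (hy : G y = _), h0] at h1
        simp at h1
        exact hpos.ne h1
      obtain ⟨w, -, rfl⟩ := hG' y hne
      have hm : minCoord w = minCoord z := by
        rw [← hsum, ← hsum, (hy : G _ = _)]
      have : w = z := by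
        ext i
        have h1 := congrFun (hy : G _ = _) i
        rw [hG, hG, hm] at h1
        exact mul_left_cancel₀ hpos.ne' h1
      rw [this]
      rfl

instance (X : SSet.{u}) : T1Space (SSet.toTop.obj X) where
  t1 x := by
    obtain ⟨m, σ, z, rfl⟩ := exists_charMap_eq x
    have := hasDimensionLT_skeleton X (m.len + 1)
    have := t1Space_of_hasDimensionLT (m.len + 1) (X.skeleton (m.len + 1)).toSSet
    obtain ⟨y, hy⟩ := mem_range_skeleton (Nat.lt_succ_self m.len) σ z
    have := (isClosedEmbedding_toTop_map (X.skeleton (m.len + 1)).ι).isClosedMap _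
      (isClosed_singleton (x := y))
    rwa [Set.image_singleton, hy] at this

end SimplicialCover

namespace SimplicialCover

/-! ### Paths generated by paths in simplices -/

/-- The smallest class of paths in `|X|` which contains the paths lying in a simplex and is closed
under concatenation and homotopy. -/
inductive SimplexGenerated {X : SSet.{u}} :
    ∀ {x y : SSet.toTop.obj X}, Path x y → Prop
  | simplex {n : SimplexCategory} (σ : X.obj (op n)) {z w : stdSimplex ℝ (Fin (n.len + 1))}
      (p : Path z w) : SimplexGenerated (p.map (charMap σ).continuous)
  | trans {x y w : SSet.toTop.obj X} {p : Path x y} {q : Path y w} :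
      SimplexGenerated p → SimplexGenerated q → SimplexGenerated (p.trans q)
  | homotopic {x y : SSet.toTop.obj X} {p q : Path x y} :
      p.Homotopic q → SimplexGenerated p → SimplexGenerated q

open Simplicial Topology

namespace SimplexGenerated

variable {X Y : SSet.{u}}

lemma congr {x y x' y' : SSet.toTop.obj X} {p : Path x y} {p' : Path x' y'}
    (hp : SimplexGenerated p) (h : ∀ t, p' t = p t) : SimplexGenerated p' := by
  obtain rfl : x' = x := by simpa using h 0
  obtain rfl : y' = y := by simpa using h 1
  obtain rfl : p' = p := by ext t; exact h t
  exact hp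

lemma of_simplex {n : SimplexCategory} (σ : X.obj (op n)) {x y : SSet.toTop.obj X} {p : Path x y}
    (q : C(unitInterval, stdSimplex ℝ (Fin (n.len + 1)))) (h : ∀ t, charMap σ (q t) = p t) :
    SimplexGenerated p :=
  (simplex σ (Path.mk q rfl rfl)).congr fun t => (h t).symm

lemma refl (x : SSet.toTop.obj X) : SimplexGenerated (Path.refl x) := by
  obtain ⟨n, σ, z, rfl⟩ := exists_charMap_eq x
  exact of_simplex σ (.const _ z) fun _ => rfl

lemma map (f : X ⟶ Y) {x y : SSet.toTop.obj X} {p : Path x y} (hp : SimplexGenerated p) :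
    SimplexGenerated (p.map (continuous_toTop_map f)) := by
  induction hp with
  | simplex σ p => exact (simplex (f.app _ σ) p).congr fun t => toTop_map_charMap f σ (p t)
  | trans _ _ h1 h2 =>
    rw [Path.map_trans]
    exact h1.trans h2
  | homotopic h _ h1 => exact h1.homotopic (h.map (SSet.toTop.map f).hom)

/-- Lebesgue's lemma subdivides the path into pieces that each lie in one member of the cover. -/
lemma of_openCover {ι : Type*} (c : ι → Set (SSet.toTop.obj X)) (hc : ∀ i, IsOpen (c i))
    {x y : SSet.toTop.obj X} (p : Path x y) (hp : ∀ t, ∃ i, p t ∈ c i)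
    (h : ∀ (i) {a b : SSet.toTop.obj X} (q : Path a b), (∀ t, q t ∈ c i) → SimplexGenerated q) :
    SimplexGenerated p := by
  obtain ⟨t, ht0, htm, ⟨N, hN⟩, ht⟩ := exists_monotone_Icc_subset_open_cover_unitInterval
    (c := fun i => p ⁻¹' c i) (fun i => (hc i).preimage p.continuous)
    fun s _ => Set.mem_iUnion.2 (hp s)
  have key : ∀ n s, s = t n → SimplexGenerated (p.subpath 0 s) := by
    intro n
    induction n with
    | zero =>
      rintro s rfl
      rw [ht0, Path.subpath_self]
      exact refl _
    | succ n ih =>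
      rintro s rfl
      obtain ⟨i, hi⟩ := ht n
      refine ((ih _ rfl).trans (h i (p.subpath (t n) (t (n + 1))) fun s => ?_)).homotopic
        ⟨Path.Homotopy.subpathTransSubpath p 0 (t n) (t (n + 1))⟩
      have : p.subpath (t n) (t (n + 1)) s ∈ Set.range (p.subpath (t n) (t (n + 1))) := ⟨s, rfl⟩
      rw [Path.range_subpath_of_le _ _ _ (htm n.le_succ)] at this
      obtain ⟨r, hr, hrs⟩ := this
      rw [← hrs]
      exact hi hr
  have := key N 1 (hN N le_rfl).symm
  rw [Path.subpath_zero_one] at this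
  exact this.congr fun _ => rfl

/-- A homotopy whose tracks are paths in simplices does not change whether a path is generated by
paths in simplices. -/
lemma of_homotopy (K : C(SSet.toTop.obj X, C(unitInterval, SSet.toTop.obj X)))
    (hK : ∀ x, K x 0 = x)
    (htrack : ∀ x, ∃ (n : SimplexCategory) (σ : X.obj (op n))
      (q : C(unitInterval, stdSimplex ℝ (Fin (n.len + 1)))), ∀ u, charMap σ (q u) = K x u)
    {x y : SSet.toTop.obj X} (p : Path x y)
    (h : ∀ {a b : SSet.toTop.obj X} (q : Path a b), (∀ t, q t = K (p t) 1) → SimplexGenerated q) :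
    SimplexGenerated p := by
  let R : C(SSet.toTop.obj X, SSet.toTop.obj X) := ⟨fun x => K x 1, by fun_prop⟩
  let Hom : ContinuousMap.Homotopy (ContinuousMap.id _) R :=
    { toFun := fun x => K x.2 x.1
      continuous_toFun := by fun_prop
      map_zero_left := hK
      map_one_left := fun _ => rfl }
  -- The path followed by the track of `y` is homotopic to the track of `x` followed by the deformed
  -- path; the track of `y` is then cancelled.
  have h1 := Path.Homotopic.map_trans_evalAt Hom p
  have hR : SimplexGenerated (p.map R.continuous) := h _ fun _ => rfl
  have ht : ∀ x, SimplexGenerated (Hom.evalAt x) := fun x => by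
    obtain ⟨n, σ, q, hq⟩ := htrack x
    exact of_simplex σ q hq
  have hts : ∀ x, SimplexGenerated (Hom.evalAt x).symm := fun x => by
    obtain ⟨n, σ, q, hq⟩ := htrack x
    exact of_simplex σ (q.comp ⟨unitInterval.symm, unitInterval.continuous_symm⟩) fun t => hq _
  have h2 : SimplexGenerated (((p.map (ContinuousMap.id _).continuous).trans
      (Hom.evalAt y)).trans (Hom.evalAt y).symm) :=
    (((ht x).trans hR).homotopic h1.symm).trans (hts y)
  have h3 : SimplexGenerated (p.map (ContinuousMap.id _).continuous) := by
    refine h2.homotopic (Path.Homotopic.Quotient.eq.1 ?_)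
    rw [Path.Homotopic.Quotient.mk_trans, Path.Homotopic.Quotient.mk_trans,
      Path.Homotopic.Quotient.mk_symm]
    simp
  exact h3.congr fun _ => rfl

end SimplexGenerated

/-! ### Pushing away from the barycenters -/

/-- The amount which is subtracted from the barycentric coordinates in `push`. -/
def pushAmount {n : ℕ} (z : stdSimplex ℝ (Fin (n + 1))) (t : unitInterval) : ℝ :=
  -- The smallest coordinate reaches its maximum `1 / (n + 1)` at the barycenter. The cap at half
  -- this value keeps the denominator in `push` at least `1 / 2`, and points below the cap still
  -- reach the boundary at time `1`.
  t * min (minCoord z) (1 / (2 * (n + 1)))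

lemma pushAmount_le {n : ℕ} (z : stdSimplex ℝ (Fin (n + 1))) (t : unitInterval) :
    pushAmount z t ≤ min (minCoord z) (1 / (2 * (n + 1))) :=
  mul_le_of_le_one_left (le_min (minCoord_nonneg z) (by positivity)) t.2.2

lemma pushAmount_lt {n : ℕ} (z : stdSimplex ℝ (Fin (n + 1))) (t : unitInterval) :
    0 < 1 - (n + 1) * pushAmount z t := by
  have h := (pushAmount_le z t).trans (min_le_right _ _)
  have hn : (0 : ℝ) < n + 1 := by positivity
  have : (n + 1) * pushAmount z t ≤ (n + 1) * (1 / (2 * (n + 1)) : ℝ) :=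
    mul_le_mul_of_nonneg_left h hn.le
  have h2 : ((n : ℝ) + 1) * (1 / (2 * (n + 1)) : ℝ) = 1 / 2 := by field_simp
  linarith

/-- The deformation of the simplex which pushes the points away from the barycenter. -/
def push {n : ℕ} : C(stdSimplex ℝ (Fin (n + 1)) × unitInterval, stdSimplex ℝ (Fin (n + 1))) where
  toFun x := ⟨fun i => (x.1 i - pushAmount x.1 x.2) / (1 - (n + 1) * pushAmount x.1 x.2),
    fun i => div_nonneg (sub_nonneg.2 (((pushAmount_le _ _).trans (min_le_left _ _)).trans
      (minCoord_le _ i))) (pushAmount_lt _ _).le, by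
      rw [← Finset.sum_div, Finset.sum_sub_distrib, stdSimplex.sum_eq_one]
      simp only [Finset.sum_const, Finset.card_univ, Fintype.card_fin, nsmul_eq_mul]
      push_cast
      exact div_self (pushAmount_lt x.1 x.2).ne'⟩
  continuous_toFun := by
    have hc : Continuous fun x : stdSimplex ℝ (Fin (n + 1)) × unitInterval =>
        pushAmount x.1 x.2 :=
      (continuous_subtype_val.comp continuous_snd).mul
        ((continuous_minCoord.comp continuous_fst).min continuous_const)
    exact (continuous_pi fun i => Continuous.div
      (((continuous_coord i).comp continuous_fst).sub hc)
      (continuous_const.sub (continuous_const.mul hc))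
      fun x => (pushAmount_lt x.1 x.2).ne').subtype_mk _

lemma push_apply {n : ℕ} (z : stdSimplex ℝ (Fin (n + 1))) (t : unitInterval) (i : Fin (n + 1)) :
    push (z, t) i = (z i - pushAmount z t) / (1 - (n + 1) * pushAmount z t) := rfl

lemma push_eq_self {n : ℕ} {z : stdSimplex ℝ (Fin (n + 1))} {t : unitInterval}
    (h : pushAmount z t = 0) : push (z, t) = z := by
  ext i
  rw [push_apply, h]
  simp

lemma push_zero {n : ℕ} (z : stdSimplex ℝ (Fin (n + 1))) : push (z, 0) = z :=
  push_eq_self (by simp [pushAmount])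

lemma push_of_apply_eq_zero {n : ℕ} {z : stdSimplex ℝ (Fin (n + 1))} (h : ∃ i, z i = 0)
    (t : unitInterval) : push (z, t) = z := by
  refine push_eq_self ?_
  rw [pushAmount, minCoord_eq_zero h, min_eq_left (by positivity), mul_zero]

lemma exists_push_one_eq_zero {n : ℕ} {z : stdSimplex ℝ (Fin (n + 1))}
    (h : minCoord z < 1 / (2 * (n + 1))) : ∃ i, push (z, 1) i = 0 := by
  obtain ⟨i, hi⟩ := exists_eq_minCoord z
  refine ⟨i, ?_⟩
  rw [push_apply, pushAmount, min_eq_left h.le, hi]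
  simp

/-! ### All paths are generated by paths in simplices -/

lemma simplexGenerated_of_mem_range {A X : SSet.{u}} (i : A ⟶ X) [Mono i]
    (hA : ∀ {x y : SSet.toTop.obj A} (p : Path x y), SimplexGenerated p)
    {x y : SSet.toTop.obj X} (p : Path x y) (hp : ∀ t, p t ∈ Set.range (SSet.toTop.map i)) :
    SimplexGenerated p := by
  choose q hq using hp
  have hc : Continuous q := by
    rw [(isClosedEmbedding_toTop_map i).continuous_iff]
    exact p.continuous.congr fun t => (hq t).symm
  exact ((hA (Path.mk ⟨q, hc⟩ rfl rfl)).map i).congr fun t => (hq t).symm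

/-- The lift of the path to the open simplex is `G` divided by the sum of its entries, hence
continuous. -/
lemma simplexGenerated_of_cell {Y : SSet.{u}} {n : ℕ} [Y.HasDimensionLT (n + 1)] {τ : Y _⦋n⦌}
    {G : C(SSet.toTop.obj Y, Fin (n + 1) → ℝ)}
    (hG : ∀ z i, G (charMap (n := ⦋n⦌) τ z) i = minCoord z * z i)
    (hG' : ∀ x, G x ≠ 0 → ∃ z : stdSimplex ℝ (Fin (n + 1)),
        (∀ i, 0 < z i) ∧ charMap (n := ⦋n⦌) τ z = x)
    {x y : SSet.toTop.obj Y} (p : Path x y) (hp : ∀ t, G (p t) ≠ 0) : SimplexGenerated p := by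
  choose q hq hqp using fun t => hG' _ (hp t)
  have hsum : ∀ t, ∑ i, G (p t) i = minCoord (q t) := fun t => by
    rw [← hqp]
    simp only [hG]
    rw [← Finset.mul_sum, stdSimplex.sum_eq_one, mul_one]
  have hne : ∀ t, ∑ i, G (p t) i ≠ 0 := fun t => (hsum t).trans_ne (minCoord_pos (hq t)).ne'
  have hc : Continuous q := by
    refine continuous_induced_rng.2 (continuous_pi fun i => ?_)
    have h : Continuous fun t => G (p t) i / ∑ j, G (p t) j :=
      Continuous.div (by fun_prop) (by fun_prop) hne
    refine h.congr fun t => ?_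
    rw [hsum]
    conv_lhs => rw [← hqp, hG]
    exact mul_div_cancel_left₀ _ (minCoord_pos (hq t)).ne'
  exact .of_simplex (n := ⦋n⦌) τ ⟨q, hc⟩ hqp

/-- The open top cells, together with the set of points near or on the lower skeleton, form an open
cover. A path in a cell lifts to a simplex. A path in the remaining set is deformed by `push`, along
tracks inside simplices, into the lower skeleton, where induction applies. -/
lemma simplexGenerated_of_hasDimensionLT (n : ℕ) (Y : SSet.{u}) [Y.HasDimensionLT n]
    {x y : SSet.toTop.obj Y} (p : Path x y) : SimplexGenerated p := by
  induction n generalizing Y with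
  | zero => exact ((isEmpty_of_hasDimensionLT_zero Y).false x).elim
  | succ n ih =>
    have hdim := hasDimensionLT_skeleton Y n
    obtain ⟨μ, hμ, hμ'⟩ := exists_extension (Y := Y) (n := n) (Z := ULift.{u} ℝ) (.const _ ⟨0⟩)
      (fun _ => ⟨fun z => ⟨minCoord z⟩, continuous_uliftUp.comp continuous_minCoord⟩)
      fun _ _ z hz => congrArg ULift.up (minCoord_eq_zero hz)
    -- The homotopy is built as a map into the path space, so that it is a map out of `|Y|` and can
    -- be defined cell by cell.
    obtain ⟨K, hK, hK'⟩ := exists_extension (Y := Y) (n := n)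
      (Z := C(unitInterval, SSet.toTop.obj Y)) (ContinuousMap.curry ⟨Prod.fst, continuous_fst⟩)
      (fun τ => ContinuousMap.curry ((charMap (n := ⦋n⦌) τ).comp push))
      fun τ _ z hz => by
        ext t
        exact congrArg (charMap (n := ⦋n⦌) τ) (push_of_apply_eq_zero hz t)
    choose! G hG hG' using fun (τ : Y _⦋n⦌) (hτ : τ ∈ Y.nonDegenerate n) => exists_cell_coords hτ
    have hKt : ∀ x, ∃ (m : SimplexCategory) (σ : Y.obj (op m))
        (q : C(unitInterval, stdSimplex ℝ (Fin (m.len + 1)))),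
        charMap σ (q 0) = x ∧ ∀ t, charMap σ (q t) = K x t := by
      intro x
      obtain ⟨k, hk, ρ, z, rfl⟩ | ⟨τ, hτ, z, hz, rfl⟩ := exists_lt_or_interior (n := n) x
      · exact ⟨⦋k⦌, ρ, .const _ z, rfl, fun t =>
          (congrArg (fun f : C(unitInterval, _) => f t) (hK' k hk ρ z)).symm⟩
      · exact ⟨⦋n⦌, τ, push.comp ⟨fun t => (z, t), by fun_prop⟩,
          congrArg (charMap (n := ⦋n⦌) τ) (push_zero z), fun t =>
          (congrArg (fun f : C(unitInterval, _) => f t) (hK τ hτ z)).symm⟩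
    refine SimplexGenerated.of_openCover
      (fun o : Option (Y.nonDegenerate n) =>
        o.elim {x | (μ x).down < 1 / (2 * (n + 1))} fun τ => {x | G τ.1 x ≠ 0}) ?_ p ?_ ?_
    · rintro (_ | τ)
      · exact isOpen_Iio.preimage (continuous_uliftDown.comp μ.continuous)
      · exact isOpen_ne.preimage (G τ.1).continuous
    · intro t
      obtain ⟨k, hk, ρ, z, hx⟩ | ⟨τ, hτ, z, hz, hx⟩ := exists_lt_or_interior (n := n) (p t)
      · refine ⟨none, ?_⟩
        have := congrArg ULift.down (hμ' k hk ρ z)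
        rw [hx] at this
        change (μ (p t)).down < _
        rw [this]
        change (0 : ℝ) < _
        positivity
      · refine ⟨some ⟨τ, hτ⟩, fun h0 => ?_⟩
        have := hG τ hτ z 0
        rw [hx, h0] at this
        exact (mul_pos (minCoord_pos hz) (hz 0)).ne this
    · rintro (_ | τ) a b q hq
      · refine SimplexGenerated.of_homotopy K ?_ ?_ q fun r hr => ?_
        · intro x
          obtain ⟨m, σ, c, h0, h⟩ := hKt x
          rw [← h, h0]
        · intro x
          obtain ⟨m, σ, c, -, h⟩ := hKt x
          exact ⟨m, σ, c, h⟩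
        · refine simplexGenerated_of_mem_range (Y.skeleton n).ι (fun p => ih _ p) r fun t => ?_
          rw [hr]
          obtain ⟨k, hk, ρ, z, hx⟩ | ⟨τ, hτ, z, hz, hx⟩ := exists_lt_or_interior (n := n) (q t)
          · rw [← hx, hK' k hk ρ z]
            exact mem_range_skeleton hk ρ z
          · have hlt : minCoord z < 1 / (2 * (n + 1)) := by
              have h1 : (μ (q t)).down < 1 / (2 * (n + 1)) := hq t
              rw [← hx, hμ τ hτ z] at h1
              exact h1
            rw [← hx, hK τ hτ z]
            obtain ⟨k, hk, ρ, w, hw⟩ := exists_face_of_apply_eq_zero τ (exists_push_one_eq_zero hlt)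
            change charMap (n := ⦋n⦌) τ (push (z, 1)) ∈ _
            rw [← hw]
            exact mem_range_skeleton hk ρ w
      · exact simplexGenerated_of_cell (hG τ.1 τ.2) (hG' τ.1 τ.2) q hq

/-- A path in `|X|` lies in the realization of a skeleton of `X`. -/
lemma exists_skeleton_of_path {X : SSet.{u}} {x y : SSet.toTop.obj X} (p : Path x y) :
    ∃ n, ∀ t, p t ∈ Set.range (SSet.toTop.map (X.skeleton n).ι) := by
  by_contra! h
  choose t ht using h
  -- The point `p (t k)` avoids the `k`-th skeleton, so a simplex meets only finitely many of these
  -- points and every tail of the sequence is closed. The complements of the tails are an increasing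
  -- open cover of the compact image, but none of them contains it.
  have hclosed : ∀ n, IsClosed {x | ∃ k ≥ n, p (t k) = x} := by
    intro n
    rw [isClosed_iff_charMap]
    intro m σ
    have : charMap σ ⁻¹' {x | ∃ k ≥ n, p (t k) = x} =
        ⋃ k ∈ Set.Icc n m.len, charMap σ ⁻¹' {p (t k)} := by
      ext z
      simp only [Set.mem_preimage, Set.mem_ofPred_eq, Set.mem_iUnion, Set.mem_Icc,
        Set.mem_singleton_iff, exists_prop]
      constructor
      · rintro ⟨k, hk, hkz⟩
        refine ⟨k, ⟨hk, not_lt.1 fun hmk => ht k ?_⟩, hkz.symm⟩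
        rw [hkz]
        exact mem_range_skeleton hmk σ z
      · rintro ⟨k, ⟨hk, -⟩, hkz⟩
        exact ⟨k, hk, hkz.symm⟩
    rw [this]
    exact (Set.finite_Icc n m.len).isClosed_biUnion fun k _ =>
      isClosed_singleton.preimage (charMap σ).continuous
  have hcompact : IsCompact (Set.range p) := isCompact_range p.continuous
  obtain ⟨n, hn⟩ := hcompact.elim_directed_cover (fun n => {x | ∃ k ≥ n, p (t k) = x}ᶜ)
    (fun n => (hclosed n).isOpen_compl) (by
      rintro _ ⟨s, rfl⟩
      obtain ⟨m, σ, z, hz⟩ := exists_charMap_eq (p s)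
      refine Set.mem_iUnion.2 ⟨m.len + 1, ?_⟩
      rintro ⟨k, hk, hks⟩
      refine ht k ?_
      rw [hks, ← hz]
      exact mem_range_skeleton hk σ z)
    (directed_of_isDirected_le fun a b hab => Set.compl_subset_compl.2
      fun x ⟨k, hk, hkx⟩ => ⟨k, hab.trans hk, hkx⟩)
  exact hn ⟨t n, rfl⟩ ⟨n, le_rfl, rfl⟩

theorem simplexGenerated {X : SSet.{u}} {x y : SSet.toTop.obj X} (p : Path x y) :
    SimplexGenerated p := by
  obtain ⟨n, hn⟩ := exists_skeleton_of_path p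
  have := hasDimensionLT_skeleton X n
  exact simplexGenerated_of_mem_range (X.skeleton n).ι
    (fun p => simplexGenerated_of_hasDimensionLT n _ p) p hn

/-! ### The fundamental group is generated by the edges -/

section Generation

variable {X : SSet.{u}} (T : MaximalTree X) (v : X _⦋0⦌)

/-- The `i`-th vertex of a simplex. -/
def vert {n : SimplexCategory} (σ : X.obj (op n)) (i : Fin (n.len + 1)) : X _⦋0⦌ :=
  X.map (SimplexCategory.const ⦋0⦌ n i).op σ

lemma vert_map {m n : SimplexCategory} (f : m ⟶ n) (σ : X.obj (op n)) (i : Fin (m.len + 1)) :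
    vert (X.map f.op σ) i = vert σ (f i) := by
  exact (map_op_comp_apply (SimplexCategory.const ⦋0⦌ m i) f σ).symm

lemma pt_vert {n : SimplexCategory} (σ : X.obj (op n)) (i : Fin (n.len + 1)) :
    pt (vert σ i) = charMap σ (stdSimplex.vertex i) := by
  rw [pt, vert, charMap_map, stdSimplex.map_vertex]
  rfl

instance (n : ℕ) : ContractibleSpace (stdSimplex ℝ (Fin (n + 1))) :=
  (convex_stdSimplex ℝ (Fin (n + 1))).contractibleSpace ⟨_, single_mem_stdSimplex ℝ 0⟩

lemma exists_path_vert {n : SimplexCategory} (σ : X.obj (op n)) (i : Fin (n.len + 1))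
    (z : stdSimplex ℝ (Fin (n.len + 1))) :
    ∃ (p : Path (pt (vert σ i)) (charMap σ z)) (q : Path (stdSimplex.vertex i) z),
      ∀ t, p t = charMap σ (q t) := by
  let q := PathConnectedSpace.somePath (stdSimplex.vertex (S := ℝ) i) z
  exact ⟨(q.map (charMap σ).continuous).cast (pt_vert σ i) rfl, q, fun _ => rfl⟩

lemma exists_edge_of_le {n : SimplexCategory} (σ : X.obj (op n)) {i j : Fin (n.len + 1)}
    (h : i ≤ j) : ∃ (e : SSet.Edge (vert σ i) (vert σ j))
      (q : Path (stdSimplex.vertex (S := ℝ) i) (stdSimplex.vertex j)),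
      ∀ t, edgePath e t = charMap σ (q t) := by
  let f := SimplexCategory.mkOfLe (n := n.len) i j h
  refine ⟨SSet.Edge.mk (X.map f.op σ) ?_ ?_,
    (stdEdge.map (stdSimplex.continuous_map f)).cast ?_ ?_, fun t => charMap_map f σ _⟩
  · exact (map_op_comp_apply (SimplexCategory.δ 1) f σ).symm.trans
      (congrArg (fun k : ⦋0⦌ ⟶ n => X.map k.op σ) (SimplexCategory.Hom.ext_zero_left _ _))
  · exact (map_op_comp_apply (SimplexCategory.δ 0) f σ).symm.trans
      (congrArg (fun k : ⦋0⦌ ⟶ n => X.map k.op σ) (SimplexCategory.Hom.ext_zero_left _ _))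
  · rw [stdSimplex.map_vertex]; rfl
  · rw [stdSimplex.map_vertex]; rfl

variable {T v} in
/-- Two ways to reach a point of a simplex through the tree and the simplex differ by an element of
every subgroup that contains the classes of the edges. -/
lemma change_mem {N : Subgroup (Pi1 X v)} (hN : ∀ e, T.edgeClass v e ∈ N) {n : SimplexCategory}
    (σ : X.obj (op n)) (i j : Fin (n.len + 1)) {z : stdSimplex ℝ (Fin (n.len + 1))}
    {x : SSet.toTop.obj X} (p : Path (pt (vert σ i)) x) (q : Path (stdSimplex.vertex i) z)
    (hp : ∀ t, p t = charMap σ (q t)) (p' : Path (pt (vert σ j)) x)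
    (q' : Path (stdSimplex.vertex j) z) (hp' : ∀ t, p' t = charMap σ (q' t)) :
    ∃ g ∈ N, T.treeArrow v (vert σ i) ≫ Path.Homotopic.Quotient.mk p =
      g.unop ≫ T.treeArrow v (vert σ j) ≫ Path.Homotopic.Quotient.mk p' := by
  have key : ∀ (i j : Fin (n.len + 1)) (_ : i ≤ j) (p : Path (pt (vert σ i)) x)
      (q : Path (stdSimplex.vertex i) z) (_ : ∀ t, p t = charMap σ (q t))
      (p' : Path (pt (vert σ j)) x) (q' : Path (stdSimplex.vertex j) z)
      (_ : ∀ t, p' t = charMap σ (q' t)), ∃ g ∈ N,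
        T.treeArrow v (vert σ i) ≫ Path.Homotopic.Quotient.mk p =
          g.unop ≫ T.treeArrow v (vert σ j) ≫ Path.Homotopic.Quotient.mk p' := by
    intro i j hij p q hp p' q' hp'
    obtain ⟨e, r, hr⟩ := exists_edge_of_le σ hij
    -- Contractibility of the simplex lets the first path be replaced by the edge followed by the
    -- second path; what remains is the loop of that edge.
    have h : edgeArrow e ≫ Path.Homotopic.Quotient.mk p' = Path.Homotopic.Quotient.mk p :=
      trans_eq_of_simplyConnected (charMap σ) r q' q (edgePath e) p' p hr hp' hp
    refine ⟨T.loop v e, T.loop_eq v e ▸ hN _, ?_⟩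
    rw [← h]
    simp [MaximalTree.loop]
  obtain hij | hij := le_total i j
  · exact key i j hij p q hp p' q' hp'
  · obtain ⟨g, hg, h⟩ := key j i hij p' q' hp' p q hp
    refine ⟨g⁻¹, N.inv_mem hg, ?_⟩
    rw [h, ← Category.assoc, ← End.mul_def, ← MulOpposite.unop_mul, inv_mul_cancel,
      MulOpposite.unop_one, End.one_def, Category.id_comp]

/-- The arrow `a` from `v` to the point `z` of the simplex `σ` is the product of an element of `N`
and of a path which runs through the tree and then through `σ`. -/
def IsStandard (N : Subgroup (Pi1 X v)) {x : SSet.toTop.obj X}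
    (a : FundamentalGroupoid.mk (pt v) ⟶ FundamentalGroupoid.mk x) (n : SimplexCategory)
    (σ : X.obj (op n)) (z : stdSimplex ℝ (Fin (n.len + 1))) : Prop :=
  ∃ g ∈ N, ∃ (i : Fin (n.len + 1)) (p : Path (pt (vert σ i)) x)
    (q : Path (stdSimplex.vertex i) z), (∀ t, p t = charMap σ (q t)) ∧
      a = g.unop ≫ T.treeArrow v (vert σ i) ≫ Path.Homotopic.Quotient.mk p

variable {T v} {N : Subgroup (Pi1 X v)}

/-- Together with `iff_of_charMap_eq`, this makes being standard independent of the simplex that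
represents the end point. In the direction back to `f^* σ`, the vertex in use may be outside the
range of `f`; `change_mem` moves it there at the cost of an element of `N`. -/
lemma isStandard_map (hN : ∀ e, T.edgeClass v e ∈ N) {x : SSet.toTop.obj X}
    (a : FundamentalGroupoid.mk (pt v) ⟶ FundamentalGroupoid.mk x) {m n : SimplexCategory}
    (f : m ⟶ n) (σ : X.obj (op n)) (z : stdSimplex ℝ (Fin (m.len + 1))) :
    IsStandard T v N a m (X.map f.op σ) z ↔ IsStandard T v N a n σ (stdSimplex.map f z) := by
  have hpush : ∀ {i : Fin (m.len + 1)} (p : Path (pt (vert (X.map f.op σ) i)) x)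
      (q : Path (stdSimplex.vertex i) z), (∀ t, p t = charMap (X.map f.op σ) (q t)) →
      ∃ (p' : Path (pt (vert σ (f i))) x)
        (q' : Path (stdSimplex.vertex (f i)) (stdSimplex.map f z)),
        (∀ t, p' t = charMap σ (q' t)) ∧
        T.treeArrow v (vert (X.map f.op σ) i) ≫ Path.Homotopic.Quotient.mk p =
          T.treeArrow v (vert σ (f i)) ≫ Path.Homotopic.Quotient.mk p' := by
    intro i p q hp
    have hq : ∀ t, p t = charMap σ ((q.map (stdSimplex.continuous_map f)).cast
        (stdSimplex.map_vertex (S := ℝ) f i).symm rfl t) := fun t =>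
      (hp t).trans (charMap_map f σ (q t))
    revert p
    rw [vert_map]
    exact fun p hp hq => ⟨p, _, hq, rfl⟩
  constructor
  · rintro ⟨g, hg, i, p, q, hp, rfl⟩
    obtain ⟨p', q', hp', h⟩ := hpush p q hp
    exact ⟨g, hg, f i, p', q', hp', by rw [h]⟩
  · rintro ⟨g, hg, i, p, q, hp, rfl⟩
    obtain rfl : x = charMap (X.map f.op σ) z := by
      rw [charMap_map]
      simpa using hp 1
    obtain ⟨r, s, hr⟩ := exists_path_vert (X.map f.op σ) 0 z
    obtain ⟨p', q', hp', h⟩ := hpush r s hr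
    obtain ⟨g', hg', h'⟩ := change_mem hN σ i (f 0) p q hp p' q' hp'
    refine ⟨g * g', N.mul_mem hg hg', 0, r, s, hr, ?_⟩
    rw [h', ← h, MulOpposite.unop_mul, End.mul_def, Category.assoc]

lemma IsStandard.trans {n : SimplexCategory} {σ : X.obj (op n)}
    {z w : stdSimplex ℝ (Fin (n.len + 1))}
    {a : FundamentalGroupoid.mk (pt v) ⟶ FundamentalGroupoid.mk (charMap σ z)}
    (ha : IsStandard T v N a n σ z) (r : Path z w) :
    IsStandard T v N (a ≫ Path.Homotopic.Quotient.mk (r.map (charMap σ).continuous)) n σ w := by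
  obtain ⟨g, hg, i, p, q, hp, rfl⟩ := ha
  refine ⟨g, hg, i, p.trans (r.map (charMap σ).continuous), q.trans r, fun t => ?_, ?_⟩
  · rw [Path.trans_apply, Path.trans_apply]
    split_ifs
    · exact hp _
    · rfl
  · rw [Path.Homotopic.Quotient.mk_trans, Category.assoc, Category.assoc]
    rfl

/-- The hypothesis on `a` covers all representatives of `x`, because each generating path comes with
a simplex of its own. -/
lemma IsStandard.comp_of_simplexGenerated (hN : ∀ e, T.edgeClass v e ∈ N)
    {x y : SSet.toTop.obj X} {p : Path x y} (hp : SimplexGenerated p)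
    (a : FundamentalGroupoid.mk (pt v) ⟶ FundamentalGroupoid.mk x)
    (ha : ∀ {n : SimplexCategory} (σ : X.obj (op n)) (z), charMap σ z = x →
      IsStandard T v N a n σ z) {n : SimplexCategory} (σ : X.obj (op n)) (z)
    (hz : charMap σ z = y) : IsStandard T v N (a ≫ Path.Homotopic.Quotient.mk p) n σ z := by
  induction hp generalizing n with
  | simplex τ r =>
    exact (iff_of_charMap_eq (IsStandard T v N _) (fun _ _ => isStandard_map hN _) hz).2
      ((ha τ _ rfl).trans r)
  | trans _ _ h1 h2 =>
    have := h2 _ (fun σ z hz => h1 a ha σ z hz) σ z hz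
    rw [Category.assoc] at this
    exact this
  | homotopic h _ ih =>
    rw [← Path.Homotopic.Quotient.eq.2 h]
    exact ih a ha σ z hz

variable (T) in
lemma treeArrow_comp_const {w : X _⦋0⦌} (h : w = v) (p : Path (pt w) (pt v))
    (hp : ∀ t, p t = pt v) : T.treeArrow v w ≫ Path.Homotopic.Quotient.mk p = 𝟙 _ := by
  subst h
  obtain rfl : p = Path.refl _ := by ext t; exact hp t
  rw [MaximalTree.treeArrow, (SimpleGraph.Walk.isPath_iff_nil.1 (T.treeWalk_isPath w w)).eq_nil]
  exact Category.id_comp _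

lemma pt_eq_charMap (w : X _⦋0⦌) (z : stdSimplex ℝ (Fin 1)) : charMap (n := ⦋0⦌) w z = pt w :=
  congrArg (charMap (n := ⦋0⦌) w) (Subsingleton.elim (α := stdSimplex ℝ (Fin 1)) _ _)

variable (T v) in
-- The trivial arrow at `v` is standard, hence so is the class of every loop. Over the `0`-simplex
-- `v` the tree part and the simplex part of a standard arrow are trivial, and only an element of
-- `N` is left.
theorem closure_range_edgeClass : Subgroup.closure (Set.range (T.edgeClass v)) = ⊤ := by
  set N := Subgroup.closure (Set.range (T.edgeClass v))
  have hN : ∀ e, T.edgeClass v e ∈ N := fun e => Subgroup.subset_closure ⟨e, rfl⟩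
  have hv : vert (n := ⦋0⦌) v 0 = v := by
    have h : SimplexCategory.const ⦋0⦌ ⦋0⦌ 0 = 𝟙 _ := SimplexCategory.Hom.ext_zero_left _ _
    rw [vert, h]
    exact map_op_id_apply v
  have h1 : IsStandard T v N (𝟙 (FundamentalGroupoid.mk (pt v))) ⦋0⦌ v
      (stdSimplex.vertex (0 : Fin 1)) := by
    refine ⟨1, N.one_mem, 0, (Path.refl _).cast (congrArg pt hv) rfl, Path.refl _, fun _ => rfl, ?_⟩
    exact (treeArrow_comp_const T hv ((Path.refl (pt v)).cast (congrArg pt hv) rfl)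
      fun _ => rfl).symm.trans (Category.id_comp _).symm
  refine eq_top_iff.2 fun g _ => ?_
  obtain ⟨p, hp⟩ := Path.Homotopic.Quotient.mk_surjective g.unop
  obtain ⟨g', hg', i, r, q, hr, h⟩ := IsStandard.comp_of_simplexGenerated hN
    (simplexGenerated p) (𝟙 _) (fun σ z hz =>
      (iff_of_charMap_eq (IsStandard T v N _) (fun _ _ => isStandard_map hN _) hz).2 h1)
    (n := ⦋0⦌) v (stdSimplex.vertex 0) rfl
  obtain rfl : i = 0 := Subsingleton.elim (α := Fin 1) _ _
  have h2 := congrArg (fun a => g'.unop ≫ a) (treeArrow_comp_const T hv r fun t =>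
    (hr t).trans (pt_eq_charMap v _))
  have h3 : g.unop = g'.unop :=
    hp.symm.trans ((Category.id_comp _).symm.trans ((h.trans h2).trans (Category.comp_id _)))
  rwa [MulOpposite.unop_injective h3]

end Generation

/-! ### Path connectedness -/

section PathConnected

lemma joined_of_arrow {Y : Type*} [TopologicalSpace Y] {x y : Y}
    (a : FundamentalGroupoid.mk x ⟶ FundamentalGroupoid.mk y) : Joined x y := by
  obtain ⟨p, -⟩ := Path.Homotopic.Quotient.mk_surjective a
  exact ⟨p⟩

lemma exists_joined_pt {X : SSet.{u}} (x : SSet.toTop.obj X) : ∃ w : X _⦋0⦌, Joined (pt w) x := by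
  obtain ⟨n, σ, z, rfl⟩ := exists_charMap_eq x
  exact ⟨_, ⟨(exists_path_vert σ 0 z).choose⟩⟩

lemma pathConnectedSpace_of_joined_pt {X : SSet.{u}} (v : X _⦋0⦌)
    (h : ∀ w : X _⦋0⦌, Joined (pt v) (pt w)) : PathConnectedSpace (SSet.toTop.obj X) := by
  refine pathConnectedSpace_iff_eq.2 ⟨pt v, Set.eq_univ_of_forall fun x => ?_⟩
  obtain ⟨w, hw⟩ := exists_joined_pt x
  exact (h w).trans hw

variable {X : SSet.{u}} (T : MaximalTree X) (v : X _⦋0⦌) {H : Type u} [Group H]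
  (χ : Pi1 X v →* H)

lemma pathConnectedSpace_toTop {X : SSet.{u}} (T : MaximalTree X) (v : X _⦋0⦌) :
    PathConnectedSpace (SSet.toTop.obj X) :=
  pathConnectedSpace_of_joined_pt v fun w => joined_of_arrow (T.treeArrow v w)

lemma joined_lift_edge (h : H) {a b : X _⦋0⦌} (e : SSet.Edge a b) :
    Joined (pt (lift T v χ h a)) (pt (lift T v χ (h * χ (T.edgeClass v e.edge)) b)) := by
  -- The source of an edge is its last face, which multiplies the label by `τ(e)⁻¹`; starting at
  -- label `h` thus requires the component `h · τ(e)`.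
  let e' : (cover T v χ) _⦋1⦌ := lift T v χ (h * χ (T.edgeClass v e.edge)) e.edge
  have h1 : (cover T v χ).δ 1 e' = lift T v χ h a := by
    refine (cover_δ_last T v χ _ e.edge).trans (Prod.ext ?_ e.src_eq)
    change h * χ (T.edgeClass v e.edge) * (tau T v χ 1 e.edge)⁻¹ = h
    rw [tau_one, mul_inv_cancel_right]
  have h0 : (cover T v χ).δ 0 e' = lift T v χ (h * χ (T.edgeClass v e.edge)) b :=
    (cover_δ T v χ 0 (by decide) _ e.edge).trans (Prod.ext rfl e.tgt_eq)
  exact ⟨edgePath (SSet.Edge.mk e' h1 h0)⟩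

lemma joined_lift_of_adj (h : H) {a b : X _⦋0⦌} (hab : T.graph.Adj a b) :
    Joined (pt (lift T v χ h a)) (pt (lift T v χ h b)) := by
  obtain ⟨e, he⟩ | ⟨e, he⟩ := T.exists_edge hab
  · simpa [T.edgeClass_of_mem v _ he] using joined_lift_edge T v χ h e
  · simpa [T.edgeClass_of_mem v _ he] using (joined_lift_edge T v χ h e).symm

lemma joined_lift (h : H) (a b : X _⦋0⦌) :
    Joined (pt (lift T v χ h a)) (pt (lift T v χ h b)) := by
  obtain p := T.treeWalk a b
  induction p with
  | nil => exact Joined.refl _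
  | cons hab _ ih => exact (joined_lift_of_adj T v χ h hab).trans ih

/-- The elements of `H` such that right translation by them does not change the path component of
the lifts of the base point. -/
def componentSubgroup : Subgroup H where
  carrier := {g | ∀ h, Joined (pt (lift T v χ h v)) (pt (lift T v χ (h * g) v))}
  one_mem' h := by rw [mul_one]
  mul_mem' {g g'} hg hg' h := by
    rw [← mul_assoc]
    exact (hg h).trans (hg' _)
  inv_mem' {g} hg h := by simpa using (hg (h * g⁻¹)).symm

lemma map_edgeClass_mem (e : X _⦋1⦌) : χ (T.edgeClass v e) ∈ componentSubgroup T v χ := fun h =>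
  (joined_lift T v χ h _ _).trans
    ((joined_lift_edge T v χ h (SSet.Edge.mk' e)).trans (joined_lift T v χ _ _ _))

theorem pathConnectedSpace_cover (hχ : Function.Surjective χ) :
    PathConnectedSpace (SSet.toTop.obj (cover T v χ)) := by
  -- The preimage of the component subgroup contains the generators of `π₁`; surjectivity of `χ`
  -- then reaches every label.
  have htop : (componentSubgroup T v χ).comap χ = ⊤ := by
    rw [eq_top_iff, ← closure_range_edgeClass T v, Subgroup.closure_le]
    rintro _ ⟨e, rfl⟩
    exact map_edgeClass_mem T v χ e
  refine pathConnectedSpace_of_joined_pt (lift T v χ 1 v) fun w => ?_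
  obtain ⟨h, a, rfl⟩ := exists_lift T v χ w
  obtain ⟨g, rfl⟩ := hχ h
  have hg : g ∈ (componentSubgroup T v χ).comap χ := htop ▸ Subgroup.mem_top g
  have := hg 1
  rw [one_mul] at this
  exact this.trans (joined_lift T v χ _ v a)

end PathConnected

end SimplicialCover

end

theorem mainTheorem1 (X : SSet.{u}) (hX : X.IsConnected)
    (T : SimplicialCover.MaximalTree X) (v : X.obj (op (SimplexCategory.mk 0)))
    (H : Type u) [Group H] (χ : SimplicialCover.Pi1 X v →* H) (hχ : Function.Surjective χ) :
    PathConnectedSpace (SSet.toTop.obj X) ∧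
      PathConnectedSpace (SSet.toTop.obj (SimplicialCover.cover T v χ)) ∧
      IsCoveringMap (SSet.toTop.map (SimplicialCover.proj T v χ)) := by
  exact ⟨SimplicialCover.pathConnectedSpace_toTop T v,
    SimplicialCover.pathConnectedSpace_cover T v χ hχ,
    (SimplicialCover.isQuotientCoveringMap_proj T v χ).isCoveringMap⟩
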